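/- Let $d\ge 1$, $1\le p<\infty$, let $\Omega\subset\mathbb{R}^d$ be open, and let $(\nu_\varepsilon)_{\varepsilon>0}$ be a family of measurable radial functions $\nu_\varepsilon:\mathbb{R}^d\setminus\{0\}\to[0,\infty]$ such that, with $a\wedge b=\min(a,b)$, $$\int_{\mathbb{R}^d}(1\wedge|h|^p)\,\nu_\varepsilon(h)\,dh=1\quad\text{for every }\varepsilon>0,\qquad \lim_{\varepsilon\to0^+}\int_{|h|>\delta}(1\wedge|h|^p)\,\nu_\varepsilon(h)\,dh=0\quad\text{for every }\delta>0.$$ For a real-valued function $u$ on $\Omega$ put $$A_p=\liminf_{\varepsilon\to0^+}\int_\Omega\int_\Omega|u(x)-u(y)|^p\,\nu_\varepsilon(x-y)\,dx\,dy\in[0,\infty],$$ and let $$K_{d,p}=\frac{1}{\sigma(\mathbb{S}^{d-1})}\int_{\mathbb{S}^{d-1}}|w\cdot e|^p\,d\sigma(w),$$ where $\sigma$ is the surface measure on the unit sphere and $e$ is any unit vector of $\mathbb{R}^d$. Let $\nabla u$ denote the distributional gradient of $u$ on $\Omega$, let $\|\nabla u\|_{L^p(\Omega)}^p=\int_\Omega|\nabla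 u|^p\,dx$, with the convention $\|\nabla u\|_{L^p(\Omega)}=\infty$ if $\nabla u$ is not a function in $L^p(\Omega)$, and let $$|u|_{BV(\Omega)}=\sup\Big\{\int_\Omega u\,\operatorname{div}\phi\,dx:\ \phi\in C_c^\infty(\Omega,\mathbb{R}^d),\ |\phi(x)|\le1\text{ for all }x\Big\}\in[0,\infty].$$ (1) If $1<p<\infty$ and $u\in L^p(\Omega)$, or if $p=1$ and $u\in W^{1,1}(\Omega)$, then $$K_{d,p}\,\|\nabla u\|_{L^p(\Omega)}^p\le A_p.$$ (2) If $p=1$ and $u\in L^1(\Omega)$, then $$K_{d,1}\,|u|_{BV(\Omega)}\le A_1.$$ -/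

import Mathlib

open MeasureTheory Filter Topology
open scoped ENNReal ContDiff

noncomputable section

/-- The family `(ν_ε)_{ε > 0}` is a Dirac approximation of `p`-Lévy measures on `ℝ^d`: every `ν_ε`
is (Lebesgue) measurable with values in `[0, ∞]`, radial, normalised by
`∫ (1 ∧ |h|^p) ν_ε(h) dh = 1`, and the mass concentrates at the origin as `ε → 0⁺`.
The value of `ν_ε` at the single point `0` plays no role. -/
structure IsDiracApproxPLevy (d : ℕ) (p : ℝ) (ν : ℝ → EuclideanSpace ℝ (Fin d) → ℝ≥0∞) :
    Prop where
  measurable : ∀ ε : ℝ, 0 < ε → AEMeasurable (ν ε) volume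
  radial : ∀ ε : ℝ, 0 < ε → ∀ x y : EuclideanSpace ℝ (Fin d), ‖x‖ = ‖y‖ → ν ε x = ν ε y
  normalized : ∀ ε : ℝ, 0 < ε →
    ∫⁻ h : EuclideanSpace ℝ (Fin d), ENNReal.ofReal (min 1 (‖h‖ ^ p)) * ν ε h = 1
  concentrates : ∀ δ : ℝ, 0 < δ →
    Tendsto (fun ε : ℝ => ∫⁻ h in {h : EuclideanSpace ℝ (Fin d) | δ < ‖h‖},
      ENNReal.ofReal (min 1 (‖h‖ ^ p)) * ν ε h) (𝓝[>] 0) (𝓝 0)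

/-- `φ ∈ C_c^∞(Ω, F)`, with `φ` extended by zero to all of `ℝ^d`. -/
structure IsTestFunction {d : ℕ} {F : Type*} [NormedAddCommGroup F] [NormedSpace ℝ F]
    (Ω : Set (EuclideanSpace ℝ (Fin d))) (φ : EuclideanSpace ℝ (Fin d) → F) : Prop where
  smooth : ContDiff ℝ ∞ φ
  hasCompactSupport : HasCompactSupport φ
  tsupport_subset : tsupport φ ⊆ Ω

/-- The `i`-th partial derivative of `φ`. -/
def partialDeriv {d : ℕ} (i : Fin d) (φ : EuclideanSpace ℝ (Fin d) → ℝ)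
    (x : EuclideanSpace ℝ (Fin d)) : ℝ :=
  fderiv ℝ φ x (EuclideanSpace.single i 1)

/-- The divergence of a vector field on `ℝ^d`. -/
def divergence {d : ℕ} (φ : EuclideanSpace ℝ (Fin d) → EuclideanSpace ℝ (Fin d))
    (x : EuclideanSpace ℝ (Fin d)) : ℝ :=
  ∑ i : Fin d, partialDeriv i (fun y => φ y i) x

/-- `g` is the distributional gradient on `Ω` of the function `u`. -/
structure IsWeakGradient {d : ℕ} (Ω : Set (EuclideanSpace ℝ (Fin d)))
    (u : EuclideanSpace ℝ (Fin d) → ℝ)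
    (g : EuclideanSpace ℝ (Fin d) → EuclideanSpace ℝ (Fin d)) : Prop where
  locallyIntegrableOn : LocallyIntegrableOn g Ω volume
  integral_eq : ∀ φ : EuclideanSpace ℝ (Fin d) → ℝ, IsTestFunction Ω φ → ∀ i : Fin d,
    ∫ x in Ω, u x * partialDeriv i φ x = -∫ x in Ω, g x i * φ x

/-- `u ∈ W^{1,p}(Ω)`. -/
def MemSobolevOne {d : ℕ} (p : ℝ) (Ω : Set (EuclideanSpace ℝ (Fin d)))
    (u : EuclideanSpace ℝ (Fin d) → ℝ) : Prop :=
  MemLp u (ENNReal.ofReal p) (volume.restrict Ω) ∧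
    ∃ g : EuclideanSpace ℝ (Fin d) → EuclideanSpace ℝ (Fin d),
      IsWeakGradient Ω u g ∧ MemLp g (ENNReal.ofReal p) (volume.restrict Ω)

/-- `‖∇u‖_{L^p(Ω)}^p = ∫_Ω |∇u|^p`, with the convention that it is `∞` if the distributional
gradient of `u` is not a function in `L^p(Ω)`. The distributional gradient is unique up to null
sets, so the infimum runs over equal values; it is `∞` if there is no gradient function. -/
def gradLpPow {d : ℕ} (p : ℝ) (Ω : Set (EuclideanSpace ℝ (Fin d)))
    (u : EuclideanSpace ℝ (Fin d) → ℝ) : ℝ≥0∞ :=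
  ⨅ (g : EuclideanSpace ℝ (Fin d) → EuclideanSpace ℝ (Fin d)) (_ : IsWeakGradient Ω u g),
    ∫⁻ x in Ω, ‖g x‖ₑ ^ p

/-- The total variation `|u|_{BV(Ω)} ∈ [0, ∞]`. The supremum is unchanged by truncating the
integrals at `0`, since `φ = 0` is admissible. -/
def bvSeminorm {d : ℕ} (Ω : Set (EuclideanSpace ℝ (Fin d)))
    (u : EuclideanSpace ℝ (Fin d) → ℝ) : ℝ≥0∞ :=
  ⨆ (φ : EuclideanSpace ℝ (Fin d) → EuclideanSpace ℝ (Fin d)) (_ : IsTestFunction Ω φ)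
    (_ : ∀ x, ‖φ x‖ ≤ 1), ENNReal.ofReal (∫ x in Ω, u x * divergence φ x)

/-- The mean value over the unit sphere of `|w · e|^p` with respect to the surface measure.
For a unit vector `e` this is the constant `K_{d,p}`, which does not depend on `e`. -/
def sphereMean (d : ℕ) (p : ℝ) (e : EuclideanSpace ℝ (Fin d)) : ℝ :=
  ⨍ w : Metric.sphere (0 : EuclideanSpace ℝ (Fin d)) 1,
    |inner ℝ (w : EuclideanSpace ℝ (Fin d)) e| ^ p
      ∂((volume : Measure (EuclideanSpace ℝ (Fin d))).toSphere)

/-- `A_p = liminf_{ε → 0⁺} ∬_{Ω×Ω} |u(x) - u(y)|^p ν_ε(x - y) dx dy`. -/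
def liminfEnergy {d : ℕ} (p : ℝ) (ν : ℝ → EuclideanSpace ℝ (Fin d) → ℝ≥0∞)
    (Ω : Set (EuclideanSpace ℝ (Fin d))) (u : EuclideanSpace ℝ (Fin d) → ℝ) : ℝ≥0∞ :=
  liminf (fun ε : ℝ => ∫⁻ x in Ω, ∫⁻ y in Ω, ‖u x - u y‖ₑ ^ p * ν ε (x - y)) (𝓝[>] 0)

end

/-! For a smooth `v` the increment `v (x + h) - v x` is `∇v(x)·h` up to a small multiple of `|h|`.
Since `ν_ε` is radial, the integral of `|∇v(x)·h|^p ν_ε(h)` over a small ball is `K_{d,p} |∇v(x)|^p`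
times the `p`-th moment of `ν_ε` on that ball, and this moment tends to `1`. Fatou's lemma
integrates the pointwise bound in `x`. A general `u` is mollified: by Jensen and translation
invariance, the nonlocal energy of `ρ ⋆ u` on a set with a margin inside `Ω` is at most that of `u`
on `Ω`. Together these bound `K_{d,p} ∫_V |∇(ρ ⋆ u)|^p` by `A_p`, uniformly in the mollifier
(`IsDiracApproxPLevy.setLIntegral_fderiv_convolution_le`).

This bound is used twice. If `u` has a weak gradient `g`, then `∇(ρ ⋆ u) = ρ ⋆ g` converges to `g`
almost everywhere on compact subsets, so a second Fatou argument and an exhaustion of `Ω` give the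
inequality (`IsWeakGradient.setLIntegral_le`). If no gradient is known, integration by parts against
a test field `φ` bounds `∫ u div φ` by `(A_p / K_{d,p})^{1/p}` times a norm of `φ`
(`IsDiracApproxPLevy.ofReal_integral_mul_divergence_le`). For `p = 1` and `|φ| ≤ 1` this is the BV
statement.

For `p > 1` and `A_p < ∞` it says that the distributional derivative is bounded for the `L^q` norm,
with `q` the conjugate exponent. Hahn–Banach and Radon–Nikodym then produce a locally integrable
density, which is a weak gradient, and the first case applies to it. That the density lies in `L^p`
need not be proved separately. For `p = 1` the conjugate exponent is infinite and the derivative may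
be only a measure, hence the assumption `u ∈ W^{1,1}`. -/

open scoped Convolution

/-! ### Radial weights and the constant `K_{d,p}` -/

/-- Polar coordinates for a function which is the product of a homogeneous function of degree `p`
and a radial function. -/
theorem lintegral_homogeneous_mul_radial {d : ℕ} {p : ℝ} {f : EuclideanSpace ℝ (Fin d) → ℝ≥0∞}
    (hf : AEMeasurable f volume)
    (hrad : ∀ x y : EuclideanSpace ℝ (Fin d), ‖x‖ = ‖y‖ → f x = f y)
    {e : EuclideanSpace ℝ (Fin d)} (he : ‖e‖ = 1)
    {G : EuclideanSpace ℝ (Fin d) → ℝ≥0∞} (hG : Measurable G)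
    (hhom : ∀ (r : ℝ) (x : EuclideanSpace ℝ (Fin d)), 0 < r → G (r • x) = ‖r‖ₑ ^ p * G x)
    (hfin : ∫⁻ w : Metric.sphere (0 : EuclideanSpace ℝ (Fin d)) 1, G w
      ∂(volume : Measure (EuclideanSpace ℝ (Fin d))).toSphere ≠ ⊤) :
    ∫⁻ h, G h * f h = (∫⁻ w : Metric.sphere (0 : EuclideanSpace ℝ (Fin d)) 1, G w
      ∂(volume : Measure (EuclideanSpace ℝ (Fin d))).toSphere) *
      ∫⁻ r : Set.Ioi (0 : ℝ), ‖(r : ℝ)‖ₑ ^ p * f ((r : ℝ) • e) ∂(Measure.volumeIoiPow (d - 1)) := by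
  have : Nontrivial (EuclideanSpace ℝ (Fin d)) := ⟨⟨e, 0, by rintro rfl; simp at he⟩⟩
  have hd : Module.finrank ℝ (EuclideanSpace ℝ (Fin d)) = d := by simp
  have hmp :=
    (volume : Measure (EuclideanSpace ℝ (Fin d))).measurePreserving_homeomorphUnitSphereProd
  rw [hd] at hmp
  have hemb := (homeomorphUnitSphereProd (EuclideanSpace ℝ (Fin d))).measurableEmbedding
  let F : Metric.sphere (0 : EuclideanSpace ℝ (Fin d)) 1 × Set.Ioi (0 : ℝ) → ℝ≥0∞ := fun z =>
    G ((z.2 : ℝ) • (z.1 : EuclideanSpace ℝ (Fin d))) *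
      f ((z.2 : ℝ) • (z.1 : EuclideanSpace ℝ (Fin d)))
  have key : ∀ x : ({(0 : EuclideanSpace ℝ (Fin d))}ᶜ : Set (EuclideanSpace ℝ (Fin d))),
      (((homeomorphUnitSphereProd (EuclideanSpace ℝ (Fin d))) x).2 : ℝ) •
      (((homeomorphUnitSphereProd (EuclideanSpace ℝ (Fin d))) x).1 : EuclideanSpace ℝ (Fin d)) = x := by
    intro x
    have h := congrArg Subtype.val
      ((homeomorphUnitSphereProd (EuclideanSpace ℝ (Fin d))).symm_apply_apply x)
    rw [homeomorphUnitSphereProd_symm_apply_coe] at h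
    exact h
  have hF : AEMeasurable F
      ((volume : Measure (EuclideanSpace ℝ (Fin d))).toSphere.prod (Measure.volumeIoiPow (d - 1))) := by
    rw [← hmp.map_eq, hemb.aemeasurable_map_iff]
    have h1 : F ∘ (homeomorphUnitSphereProd (EuclideanSpace ℝ (Fin d))) =
        (fun h => G h * f h) ∘ Subtype.val := by
      ext x
      simp only [F, Function.comp, key]
    rw [h1]
    refine AEMeasurable.comp_measurable ?_ measurable_subtype_coe
    rw [(MeasurableEmbedding.subtype_coe
      (measurableSet_singleton (0 : EuclideanSpace ℝ (Fin d))).compl).map_comap]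
    exact (hG.aemeasurable.mul hf).mono_measure Measure.restrict_le_self
  calc ∫⁻ h, G h * f h
      = ∫⁻ h in ({(0 : EuclideanSpace ℝ (Fin d))}ᶜ : Set (EuclideanSpace ℝ (Fin d))), G h * f h := by
        rw [restrict_compl_singleton]
    _ = ∫⁻ x : ({(0 : EuclideanSpace ℝ (Fin d))}ᶜ : Set (EuclideanSpace ℝ (Fin d))),
          F (homeomorphUnitSphereProd (EuclideanSpace ℝ (Fin d)) x)
          ∂(Measure.comap Subtype.val volume) := by
        rw [← lintegral_subtype_comap (measurableSet_singleton _).compl]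
        refine lintegral_congr fun x => ?_
        simp only [F, key]
    _ = ∫⁻ r : Set.Ioi (0 : ℝ), ∫⁻ w : Metric.sphere (0 : EuclideanSpace ℝ (Fin d)) 1, F (w, r)
          ∂(volume : Measure (EuclideanSpace ℝ (Fin d))).toSphere ∂(Measure.volumeIoiPow (d - 1)) := by
        rw [hmp.lintegral_comp_emb hemb, lintegral_prod_symm _ hF]
    _ = ∫⁻ r : Set.Ioi (0 : ℝ), (∫⁻ w : Metric.sphere (0 : EuclideanSpace ℝ (Fin d)) 1, G w
          ∂(volume : Measure (EuclideanSpace ℝ (Fin d))).toSphere) *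
          (‖(r : ℝ)‖ₑ ^ p * f ((r : ℝ) • e)) ∂(Measure.volumeIoiPow (d - 1)) := by
        -- Homogeneity takes `r ^ p` out of `G`, and radiality replaces the direction `w` by `e`
        -- inside `f`, so only `G w` still depends on `w`.
        refine lintegral_congr fun r => ?_
        rw [← lintegral_mul_const (f := fun w : Metric.sphere (0 : EuclideanSpace ℝ (Fin d)) 1 =>
          G w) _ (hG.comp measurable_subtype_coe)]
        refine lintegral_congr fun w => ?_
        have hw : ‖(w : EuclideanSpace ℝ (Fin d))‖ = 1 := by simp
        simp only [F, hhom _ _ r.2]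
        rw [hrad ((r : ℝ) • (w : EuclideanSpace ℝ (Fin d))) ((r : ℝ) • e) (by simp [norm_smul, he])]
        ring
    _ = _ := lintegral_const_mul' _ _ hfin

theorem ofReal_sphereMean {d : ℕ} {p : ℝ} (hp : 0 ≤ p) (e : EuclideanSpace ℝ (Fin d)) :
    ENNReal.ofReal (sphereMean d p e) =
      (∫⁻ w : Metric.sphere (0 : EuclideanSpace ℝ (Fin d)) 1,
        ‖inner ℝ (w : EuclideanSpace ℝ (Fin d)) e‖ₑ ^ p
        ∂(volume : Measure (EuclideanSpace ℝ (Fin d))).toSphere) /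
      (volume : Measure (EuclideanSpace ℝ (Fin d))).toSphere Set.univ := by
  have hcont : Continuous fun w : Metric.sphere (0 : EuclideanSpace ℝ (Fin d)) 1 =>
      |inner ℝ (w : EuclideanSpace ℝ (Fin d)) e| ^ p :=
    ((continuous_subtype_val.inner continuous_const).abs).rpow_const fun _ => Or.inr hp
  have hint := hcont.integrable_of_hasCompactSupport
    (μ := (volume : Measure (EuclideanSpace ℝ (Fin d))).toSphere)
    (HasCompactSupport.of_compactSpace _)
  rw [sphereMean, ofReal_average hint (ae_of_all _ fun w => by positivity)]
  congr 1
  refine lintegral_congr fun w => ?_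
  rw [← ENNReal.ofReal_rpow_of_nonneg (abs_nonneg _) hp, Real.enorm_eq_ofReal_abs]

theorem lintegral_inner_rpow_sphere_ne_top {d : ℕ} {p : ℝ} (hp : 0 ≤ p)
    (e : EuclideanSpace ℝ (Fin d)) :
    ∫⁻ w : Metric.sphere (0 : EuclideanSpace ℝ (Fin d)) 1,
        ‖inner ℝ (w : EuclideanSpace ℝ (Fin d)) e‖ₑ ^ p
        ∂(volume : Measure (EuclideanSpace ℝ (Fin d))).toSphere ≠ ⊤ := by
  refine ne_top_of_le_ne_top ?_ (lintegral_mono (g := fun _ => ‖e‖ₑ ^ p) fun w => ?_)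
  · rw [lintegral_const]
    exact ENNReal.mul_ne_top (ENNReal.rpow_ne_top_of_nonneg hp enorm_ne_top) (measure_ne_top _ _)
  · refine ENNReal.rpow_le_rpow ?_ hp
    have hw : ‖(w : EuclideanSpace ℝ (Fin d))‖ = 1 := by simp
    rw [enorm_le_iff_norm_le]
    simpa [hw] using norm_inner_le_norm (𝕜 := ℝ) (w : EuclideanSpace ℝ (Fin d)) e

/-- In polar coordinates both integrals have the same radial factor. Their spherical factors are the
integral of `|w · e|^p` and the total mass of the sphere, whose quotient is the mean. -/
theorem lintegral_inner_rpow_mul_radial {d : ℕ} {p : ℝ} (hp : 0 ≤ p)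
    {f : EuclideanSpace ℝ (Fin d) → ℝ≥0∞}
    (hf : AEMeasurable f volume)
    (hrad : ∀ x y : EuclideanSpace ℝ (Fin d), ‖x‖ = ‖y‖ → f x = f y)
    {e : EuclideanSpace ℝ (Fin d)} (he : ‖e‖ = 1) :
    ∫⁻ h, ‖inner ℝ h e‖ₑ ^ p * f h =
      ENNReal.ofReal (sphereMean d p e) * ∫⁻ h, ‖h‖ₑ ^ p * f h := by
  have : Nontrivial (EuclideanSpace ℝ (Fin d)) := ⟨⟨e, 0, by rintro rfl; simp at he⟩⟩
  have h1 : ∫⁻ w : Metric.sphere (0 : EuclideanSpace ℝ (Fin d)) 1,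
      ‖(w : EuclideanSpace ℝ (Fin d))‖ₑ ^ p
      ∂(volume : Measure (EuclideanSpace ℝ (Fin d))).toSphere =
      (volume : Measure (EuclideanSpace ℝ (Fin d))).toSphere Set.univ := by
    rw [← lintegral_one]
    refine lintegral_congr fun w => ?_
    have hw : ‖(w : EuclideanSpace ℝ (Fin d))‖ = 1 := by simp
    rw [← ofReal_norm, hw]
    simp
  rw [lintegral_homogeneous_mul_radial (p := p) hf hrad he (by fun_prop) ?_
      (lintegral_inner_rpow_sphere_ne_top hp e),
    lintegral_homogeneous_mul_radial (p := p) hf hrad he (G := fun h => ‖h‖ₑ ^ p)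
      (by fun_prop) ?_ ?_, h1, ← mul_assoc, ofReal_sphereMean hp,
    ENNReal.div_mul_cancel ?_ (measure_ne_top _ _)]
  · simp only [ne_eq, Measure.measure_univ_eq_zero]
    exact Measure.toSphere_ne_zero _
  · intro r x _
    rw [enorm_smul, ENNReal.mul_rpow_of_nonneg _ _ hp]
  · rw [h1]; exact measure_ne_top _ _
  · intro r x _
    rw [inner_smul_left, enorm_mul, ENNReal.mul_rpow_of_nonneg _ _ hp]
    simp

/-- For a radial weight `f`, the weighted `L^p` norm of a linear functional only depends on its
norm. -/
theorem lintegral_functional_rpow_mul_radial {d : ℕ} {p : ℝ} (hp : 0 < p)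
    {f : EuclideanSpace ℝ (Fin d) → ℝ≥0∞}
    (hf : AEMeasurable f volume)
    (hrad : ∀ x y : EuclideanSpace ℝ (Fin d), ‖x‖ = ‖y‖ → f x = f y)
    {e : EuclideanSpace ℝ (Fin d)} (he : ‖e‖ = 1) (ℓ : EuclideanSpace ℝ (Fin d) →L[ℝ] ℝ) :
    ∫⁻ h, ‖ℓ h‖ₑ ^ p * f h =
      ENNReal.ofReal (sphereMean d p e) * ‖ℓ‖ₑ ^ p * ∫⁻ h, ‖h‖ₑ ^ p * f h := by
  obtain ⟨a, rfl⟩ := (InnerProductSpace.toDual ℝ (EuclideanSpace ℝ (Fin d))).surjective ℓ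
  have hnorm : ‖‖a‖ • e‖ = ‖a‖ := by simp [norm_smul, he]
  -- The reflection exchanging `‖a‖ • e` and `a` preserves volume and norms, so the functional
  -- represented by `a` may be replaced by the one represented by `‖a‖ • e`.
  set R := (Submodule.span ℝ {‖a‖ • e - a})ᗮ.reflection with hR
  have hRa : R (‖a‖ • e) = a := Submodule.reflection_sub hnorm
  have hRR : ∀ x, R (R x) = x := Submodule.reflection_reflection _
  have hmp : MeasurePreserving R volume volume := R.measurePreserving
  rw [← hmp.lintegral_comp_emb R.toHomeomorph.measurableEmbedding]
  have h2 : ∀ x, ‖(InnerProductSpace.toDual ℝ (EuclideanSpace ℝ (Fin d))) a (R x)‖ₑ ^ p * f (R x)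
      = ‖a‖ₑ ^ p * (‖inner ℝ x e‖ₑ ^ p * f x) := by
    intro x
    rw [hrad (R x) x (R.norm_map x), InnerProductSpace.toDual_apply_apply]
    nth_rewrite 1 [← hRa]
    rw [R.inner_map_map, inner_smul_left, real_inner_comm, enorm_mul,
      ENNReal.mul_rpow_of_nonneg _ _ hp.le]
    simp [mul_assoc]
  simp_rw [h2]
  rw [lintegral_const_mul' _ _ (ENNReal.rpow_ne_top_of_nonneg hp.le enorm_ne_top),
    lintegral_inner_rpow_mul_radial hp.le hf hrad he]
  have h3 : ‖(InnerProductSpace.toDual ℝ (EuclideanSpace ℝ (Fin d))) a‖ₑ = ‖a‖ₑ := by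
    rw [← ofReal_norm, ← ofReal_norm, LinearIsometryEquiv.norm_map]
  rw [h3]
  ring

/-- A continuous nonnegative function with zero integral over the sphere vanishes identically, but
`|w · e|^p` equals `1` at `w = e`. Positivity is what later allows division by the constant. -/
theorem sphereMean_pos {d : ℕ} {p : ℝ} (hp : 0 < p) {e : EuclideanSpace ℝ (Fin d)}
    (he : ‖e‖ = 1) : 0 < sphereMean d p e := by
  rw [← ENNReal.ofReal_pos, pos_iff_ne_zero, ofReal_sphereMean hp.le, ENNReal.div_ne_zero]
  refine ⟨?_, measure_ne_top _ _⟩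
  intro h0
  have hcont : Continuous fun w : Metric.sphere (0 : EuclideanSpace ℝ (Fin d)) 1 =>
      ‖inner ℝ (w : EuclideanSpace ℝ (Fin d)) e‖ₑ ^ p :=
    ENNReal.continuous_rpow_const.comp
      (continuous_enorm.comp (continuous_subtype_val.inner continuous_const))
  rw [lintegral_eq_zero_iff hcont.measurable, hcont.ae_eq_iff_eq _ continuous_zero] at h0
  have h1 := congrFun h0 ⟨e, by simpa using he⟩
  simp [he] at h1

/-! ### Concentration of moments and the pointwise lower bound -/

theorem ofReal_min_one_norm_rpow_eq {d : ℕ} {p : ℝ} (hp : 0 ≤ p) {h : EuclideanSpace ℝ (Fin d)}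
    (hh : ‖h‖ ≤ 1) : ENNReal.ofReal (min 1 (‖h‖ ^ p)) = ‖h‖ₑ ^ p := by
  rw [min_eq_right (Real.rpow_le_one (norm_nonneg _) hh hp),
    ← ENNReal.ofReal_rpow_of_nonneg (norm_nonneg _) hp, ofReal_norm]

/-- The `p`-th moments of a Dirac approximation over small balls converge to `1`. -/
theorem IsDiracApproxPLevy.tendsto_setLIntegral_ball {d : ℕ} {p : ℝ} (hp : 0 ≤ p)
    {ν : ℝ → EuclideanSpace ℝ (Fin d) → ℝ≥0∞} (hν : IsDiracApproxPLevy d p ν)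
    {r : ℝ} (hr : 0 < r) (hr1 : r ≤ 1) :
    Tendsto (fun ε => ∫⁻ h in Metric.ball (0 : EuclideanSpace ℝ (Fin d)) r, ‖h‖ₑ ^ p * ν ε h)
      (𝓝[>] 0) (𝓝 1) := by
  have heq : ∀ ε, ∫⁻ h in Metric.ball (0 : EuclideanSpace ℝ (Fin d)) r, ‖h‖ₑ ^ p * ν ε h =
      ∫⁻ h in Metric.ball (0 : EuclideanSpace ℝ (Fin d)) r,
        ENNReal.ofReal (min 1 (‖h‖ ^ p)) * ν ε h := by
    intro ε
    refine setLIntegral_congr_fun measurableSet_ball fun h hh => ?_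
    have : ‖h‖ < r := mem_ball_zero_iff.1 hh
    simp only [ofReal_min_one_norm_rpow_eq hp (this.le.trans hr1)]
  simp_rw [heq]
  -- The moment lies between `1` minus a tail and `1`. The tail is taken at radius `r / 2` because
  -- the complement of the open ball contains points with `‖h‖ = r`, whereas concentration concerns
  -- strict inequalities.
  have hlim := ENNReal.Tendsto.sub (tendsto_const_nhds (x := (1 : ℝ≥0∞)) (f := 𝓝[>] (0 : ℝ)))
    (hν.concentrates (r / 2) (half_pos hr)) (Or.inl ENNReal.one_ne_top)
  rw [tsub_zero] at hlim
  refine tendsto_of_tendsto_of_tendsto_of_le_of_le' hlim tendsto_const_nhds ?_ ?_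
  · filter_upwards [self_mem_nhdsWithin] with ε hε
    rw [tsub_le_iff_right, ← hν.normalized ε hε]
    rw [← setLIntegral_univ]
    refine le_trans (lintegral_mono_set ?_) (lintegral_union_le _ _ _)
    intro h _
    by_cases hh : ‖h‖ < r
    · left; simpa using hh
    · right; simp only [Set.mem_ofPred_eq]; linarith
  · filter_upwards [self_mem_nhdsWithin] with ε hε
    rw [← hν.normalized ε hε]
    exact setLIntegral_le_lintegral _ _

/-- A radial weight cut off to a centred ball is still radial. -/
theorem setLIntegral_functional_rpow_mul {d : ℕ} {p : ℝ} (hp : 0 < p)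
    {f : EuclideanSpace ℝ (Fin d) → ℝ≥0∞} (hf : AEMeasurable f volume)
    (hrad : ∀ x y : EuclideanSpace ℝ (Fin d), ‖x‖ = ‖y‖ → f x = f y)
    {e : EuclideanSpace ℝ (Fin d)} (he : ‖e‖ = 1) (ℓ : EuclideanSpace ℝ (Fin d) →L[ℝ] ℝ) (r : ℝ) :
    ∫⁻ h in Metric.ball 0 r, ‖ℓ h‖ₑ ^ p * f h =
      ENNReal.ofReal (sphereMean d p e) * ‖ℓ‖ₑ ^ p *
        ∫⁻ h in Metric.ball 0 r, ‖h‖ₑ ^ p * f h := by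
  have key := lintegral_functional_rpow_mul_radial hp
    (f := (Metric.ball (0 : EuclideanSpace ℝ (Fin d)) r).indicator f)
    (hf.indicator measurableSet_ball) (fun x y hxy => by
      simp only [Set.indicator, mem_ball_zero_iff, hxy, hrad x y hxy]) he ℓ
  rw [← lintegral_indicator measurableSet_ball, ← lintegral_indicator measurableSet_ball]
  simpa only [Set.indicator_mul_right] using key

/-- Minkowski's inequality for the linearization of `v` at `x`. -/
theorem rpow_functional_le_rpow_increment_add {d : ℕ} {p : ℝ} (hp : 1 ≤ p)
    {f : EuclideanSpace ℝ (Fin d) → ℝ≥0∞} (hf : AEMeasurable f volume)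
    {v : EuclideanSpace ℝ (Fin d) → ℝ} (hv : Measurable v) {x : EuclideanSpace ℝ (Fin d)}
    (ℓ : EuclideanSpace ℝ (Fin d) →L[ℝ] ℝ) {r η : ℝ} (hη : 0 ≤ η)
    (hr : ∀ h ∈ Metric.ball (0 : EuclideanSpace ℝ (Fin d)) r,
      ‖v (x + h) - v x - ℓ h‖ ≤ η * ‖h‖) :
    (∫⁻ h in Metric.ball 0 r, ‖ℓ h‖ₑ ^ p * f h) ^ (1 / p) ≤
      (∫⁻ h in Metric.ball 0 r, ‖v (x + h) - v x‖ₑ ^ p * f h) ^ (1 / p) +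
        ENNReal.ofReal η * (∫⁻ h in Metric.ball 0 r, ‖h‖ₑ ^ p * f h) ^ (1 / p) := by
  have hp0 : 0 < p := one_pos.trans_le hp
  have hf' : AEMeasurable f (volume.restrict (Metric.ball 0 r)) :=
    hf.mono_measure Measure.restrict_le_self
  -- With the weight absorbed into the measure, the claim is the triangle inequality in `L^p(μ)`.
  set μ := (volume.restrict (Metric.ball (0 : EuclideanSpace ℝ (Fin d)) r)).withDensity f with hμ
  have hcv : ∀ g : EuclideanSpace ℝ (Fin d) → ℝ≥0∞, Measurable g →
      ∫⁻ h in Metric.ball 0 r, g h ^ p * f h = ∫⁻ h, g h ^ p ∂μ := by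
    intro g hg
    rw [hμ, lintegral_withDensity_eq_lintegral_mul₀ hf' (by fun_prop)]
    simp [mul_comm]
  have hη' : ENNReal.ofReal η * (∫⁻ h in Metric.ball 0 r, ‖h‖ₑ ^ p * f h) ^ (1 / p) =
      (∫⁻ h, (ENNReal.ofReal η * ‖h‖ₑ) ^ p ∂μ) ^ (1 / p) := by
    rw [hcv _ (by fun_prop)]
    simp_rw [ENNReal.mul_rpow_of_nonneg _ _ hp0.le]
    rw [lintegral_const_mul' _ _ (ENNReal.rpow_ne_top_of_nonneg hp0.le ENNReal.ofReal_ne_top),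
      ENNReal.mul_rpow_of_nonneg _ _ (by positivity), ← ENNReal.rpow_mul,
      mul_one_div_cancel hp0.ne', ENNReal.rpow_one]
  rw [hη', hcv _ (by fun_prop), hcv _ (by fun_prop)]
  refine le_trans (ENNReal.rpow_le_rpow (lintegral_mono_ae ?_) (by positivity))
    (ENNReal.lintegral_Lp_add_le (by fun_prop) (by fun_prop) hp)
  have hae : ∀ᵐ h ∂μ, h ∈ Metric.ball (0 : EuclideanSpace ℝ (Fin d)) r :=
    (withDensity_absolutelyContinuous _ _).ae_le (ae_restrict_mem measurableSet_ball)
  filter_upwards [hae] with h hh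
  refine ENNReal.rpow_le_rpow ?_ hp0.le
  simp only [Pi.add_apply]
  rw [← ofReal_norm, ← ofReal_norm, ← ofReal_norm, ← ENNReal.ofReal_mul hη,
    ← ENNReal.ofReal_add (norm_nonneg _) (by positivity)]
  refine ENNReal.ofReal_le_ofReal ?_
  have h1 := hr h hh
  have h2 : ‖ℓ h‖ ≤ ‖v (x + h) - v x‖ + ‖v (x + h) - v x - ℓ h‖ := by
    have := norm_sub_le (v (x + h) - v x) (v (x + h) - v x - ℓ h)
    simpa using this
  linarith

/-- The nonlocal energy density at a point of differentiability is asymptotically at least the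
local one. -/
theorem IsDiracApproxPLevy.le_liminf_setLIntegral_ball {d : ℕ} {p : ℝ} (hp : 1 ≤ p)
    {ν : ℝ → EuclideanSpace ℝ (Fin d) → ℝ≥0∞} (hν : IsDiracApproxPLevy d p ν)
    {e : EuclideanSpace ℝ (Fin d)} (he : ‖e‖ = 1)
    {v : EuclideanSpace ℝ (Fin d) → ℝ} (hv : Measurable v) {x : EuclideanSpace ℝ (Fin d)}
    (hx : DifferentiableAt ℝ v x) {δ : ℝ} (hδ : 0 < δ) :
    ENNReal.ofReal (sphereMean d p e) * ‖fderiv ℝ v x‖ₑ ^ p ≤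
      liminf (fun ε => ∫⁻ h in Metric.ball (0 : EuclideanSpace ℝ (Fin d)) δ,
        ‖v (x + h) - v x‖ₑ ^ p * ν ε h) (𝓝[>] 0) := by
  have hp0 : 0 < p := one_pos.trans_le hp
  have hip : 0 < 1 / p := by positivity
  -- Taking `p`-th roots prepares for Minkowski's inequality. The root is an order isomorphism of
  -- `[0, ∞]`, so it commutes with the liminf.
  rw [← ENNReal.rpow_le_rpow_iff hip]
  have hlim := OrderIso.liminf_apply (f := 𝓝[>] (0 : ℝ)) (u := fun ε =>
    ∫⁻ h in Metric.ball (0 : EuclideanSpace ℝ (Fin d)) δ, ‖v (x + h) - v x‖ₑ ^ p * ν ε h)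
    (ENNReal.orderIsoRpow (1 / p) hip)
  simp only [ENNReal.orderIsoRpow_apply] at hlim
  rw [hlim]
  refine ENNReal.le_of_forall_pos_le_add fun η hη _ => ?_
  obtain ⟨r₀, hr₀, hball⟩ := Metric.eventually_nhds_iff_ball.1
    (hasFDerivAt_iff_isLittleO_nhds_zero.1 hx.hasFDerivAt |>.def (NNReal.coe_pos.2 hη))
  set r := min r₀ (min 1 δ) with hrdef
  have hr : 0 < r := by positivity
  have hr1 : r ≤ 1 := (min_le_right _ _).trans (min_le_left _ _)
  have hrδ : r ≤ δ := (min_le_right _ _).trans (min_le_right _ _)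
  -- With `η` on the left, that side is the limit of expressions depending on `ε`, which can be
  -- compared with the right side for each `ε`.
  rw [← tsub_le_iff_right]
  have hm := hν.tendsto_setLIntegral_ball hp0.le hr hr1
  have hL := ENNReal.Tendsto.sub (((ENNReal.continuous_rpow_const (y := 1 / p)).tendsto _).comp
    (ENNReal.Tendsto.const_mul (a := ENNReal.ofReal (sphereMean d p e) * ‖fderiv ℝ v x‖ₑ ^ p)
      hm (Or.inl one_ne_zero))) (tendsto_const_nhds (x := (η : ℝ≥0∞)))
      (Or.inr ENNReal.coe_ne_top)
  rw [mul_one] at hL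
  rw [← hL.liminf_eq]
  refine liminf_le_liminf ?_
  filter_upwards [self_mem_nhdsWithin] with ε hε
  simp only [Function.comp]
  rw [tsub_le_iff_right, ← setLIntegral_functional_rpow_mul hp0 (hν.measurable ε hε)
    (hν.radial ε hε) he]
  refine (rpow_functional_le_rpow_increment_add hp (hν.measurable ε hε) hv (fderiv ℝ v x)
    η.coe_nonneg fun h hh => hball h (Metric.ball_subset_ball (min_le_left _ _) hh)).trans ?_
  refine add_le_add (ENNReal.rpow_le_rpow
    (lintegral_mono_set (Metric.ball_subset_ball hrδ)) hip.le) ?_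
  rw [ENNReal.ofReal_coe_nnreal]
  refine mul_le_of_le_one_right' (ENNReal.rpow_le_one ?_ hip.le)
  rw [← hν.normalized ε hε]
  refine le_trans (le_of_eq ?_) (setLIntegral_le_lintegral (Metric.ball 0 r) _)
  refine setLIntegral_congr_fun measurableSet_ball fun h hh => ?_
  have : ‖h‖ < r := mem_ball_zero_iff.1 hh
  simp only [ofReal_min_one_norm_rpow_eq hp0.le (this.le.trans hr1)]

/-! ### Mollification and the nonlocal energy -/

/-- Jensen's inequality, read off from the monotonicity of `L^p` norms in the exponent on a
probability space. -/
theorem lintegral_rpow_le_lintegral_rpow {α : Type*} [MeasurableSpace α] {P : Measure α}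
    [IsProbabilityMeasure P] {p : ℝ} (hp : 1 ≤ p) {g : α → ℝ≥0∞} (hg : AEMeasurable g P) :
    (∫⁻ t, g t ∂P) ^ p ≤ ∫⁻ t, g t ^ p ∂P := by
  have hp0 : 0 < p := one_pos.trans_le hp
  have h := eLpNorm_le_eLpNorm_of_exponent_le (μ := P) (f := g) (p := 1) (q := ENNReal.ofReal p)
    (by simpa using hp) hg.aestronglyMeasurable
  rw [eLpNorm_one_eq_lintegral_enorm, eLpNorm_eq_lintegral_rpow_enorm_toReal (by simpa using hp0)
    ENNReal.ofReal_ne_top, ENNReal.toReal_ofReal hp0.le] at h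
  simp only [enorm_eq_self] at h
  calc (∫⁻ t, g t ∂P) ^ p ≤ ((∫⁻ t, g t ^ p ∂P) ^ (1 / p)) ^ p := ENNReal.rpow_le_rpow h hp0.le
    _ = _ := by rw [← ENNReal.rpow_mul, one_div_mul_cancel hp0.ne', ENNReal.rpow_one]

/-- Jensen's inequality for the increments of a mollified function. -/
theorem enorm_convolution_sub_rpow_le {d : ℕ} {p : ℝ} (hp : 1 ≤ p)
    (ρ : ContDiffBump (0 : EuclideanSpace ℝ (Fin d)))
    {w : EuclideanSpace ℝ (Fin d) → ℝ} (hw : Measurable w) (hwi : LocallyIntegrable w volume)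
    (x y : EuclideanSpace ℝ (Fin d)) :
    ‖(ρ.normed volume ⋆[ContinuousLinearMap.lsmul ℝ ℝ, volume] w) y -
      (ρ.normed volume ⋆[ContinuousLinearMap.lsmul ℝ ℝ, volume] w) x‖ₑ ^ p ≤
      ∫⁻ t, ENNReal.ofReal (ρ.normed volume t) * ‖w (y - t) - w (x - t)‖ₑ ^ p := by
  have hp0 : 0 < p := one_pos.trans_le hp
  have hρm : Measurable (ρ.normed (volume : Measure (EuclideanSpace ℝ (Fin d)))) :=
    ρ.continuous_normed.measurable
  set P := (volume : Measure (EuclideanSpace ℝ (Fin d))).withDensity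
    (fun t => ENNReal.ofReal (ρ.normed volume t)) with hP
  have hprob : IsProbabilityMeasure P := by
    refine ⟨?_⟩
    rw [hP, withDensity_apply _ MeasurableSet.univ, setLIntegral_univ,
      ← ofReal_integral_eq_lintegral_ofReal ρ.integrable_normed
        (ae_of_all _ fun t => ρ.nonneg_normed t), ρ.integral_normed, ENNReal.ofReal_one]
  have hcv : ∀ g : EuclideanSpace ℝ (Fin d) → ℝ≥0∞, Measurable g →
      ∫⁻ t, ENNReal.ofReal (ρ.normed volume t) * g t = ∫⁻ t, g t ∂P := by
    intro g hg
    rw [hP, lintegral_withDensity_eq_lintegral_mul _ (by fun_prop) hg]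
    rfl
  rw [hcv _ (by fun_prop)]
  refine le_trans (ENNReal.rpow_le_rpow ?_ hp0.le) (lintegral_rpow_le_lintegral_rpow hp
    (by fun_prop : Measurable fun t => ‖w (y - t) - w (x - t)‖ₑ).aemeasurable)
  rw [← hcv _ (by fun_prop)]
  have hex := (ρ.hasCompactSupport_normed (μ := volume)).convolutionExists_left
    (ContinuousLinearMap.lsmul ℝ ℝ) ρ.continuous_normed hwi
  rw [convolution_def, convolution_def, ← integral_sub (hex y) (hex x)]
  refine (enorm_integral_le_lintegral_enorm _).trans (le_of_eq (lintegral_congr fun t => ?_))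
  rw [← map_sub, ContinuousLinearMap.lsmul_apply, enorm_smul,
    Real.enorm_eq_ofReal (ρ.nonneg_normed t)]

/-- Substitute `z = y + h` and use that `f` is even; the ball of increments around `y` is only a
part of `Ω`. -/
theorem setLIntegral_ball_increment_le {d : ℕ} {p : ℝ}
    {f : EuclideanSpace ℝ (Fin d) → ℝ≥0∞} (hsymm : ∀ h, f (-h) = f h)
    (w : EuclideanSpace ℝ (Fin d) → ℝ) {Ω : Set (EuclideanSpace ℝ (Fin d))}
    {y : EuclideanSpace ℝ (Fin d)} {δ : ℝ} (hy : Metric.ball y δ ⊆ Ω) :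
    ∫⁻ h in Metric.ball 0 δ, ‖w (y + h) - w y‖ₑ ^ p * f h ≤
      ∫⁻ z in Ω, ‖w y - w z‖ₑ ^ p * f (y - z) := by
  refine le_trans (le_of_eq ?_) (lintegral_mono_set hy)
  rw [← lintegral_indicator measurableSet_ball, ← lintegral_indicator measurableSet_ball,
    ← lintegral_add_left_eq_self ((Metric.ball y δ).indicator _) y]
  refine lintegral_congr fun h => ?_
  by_cases hh : ‖h‖ < δ
  · rw [Set.indicator_of_mem (by simpa using hh), Set.indicator_of_mem (by simpa using hh),
      enorm_sub_rev, sub_add_cancel_left, hsymm]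
  · rw [Set.indicator_of_notMem (by simpa using hh), Set.indicator_of_notMem (by simpa using hh)]

/-- Mollification does not increase the nonlocal energy. -/
theorem setLIntegral_convolution_increment_le {d : ℕ} {p : ℝ} (hp : 1 ≤ p)
    {f : EuclideanSpace ℝ (Fin d) → ℝ≥0∞} (hf : AEMeasurable f volume)
    (hsymm : ∀ h, f (-h) = f h)
    (ρ : ContDiffBump (0 : EuclideanSpace ℝ (Fin d)))
    {w : EuclideanSpace ℝ (Fin d) → ℝ} (hw : Measurable w) (hwi : LocallyIntegrable w volume)
    {Ω V : Set (EuclideanSpace ℝ (Fin d))} (hΩ : MeasurableSet Ω) {δ : ℝ} (hδ : 0 < δ)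
    (hV : ∀ x ∈ V, Metric.ball x (ρ.rOut + δ) ⊆ Ω) (hVm : MeasurableSet V) :
    ∫⁻ x in V, ∫⁻ h in Metric.ball 0 δ,
      ‖(ρ.normed volume ⋆[ContinuousLinearMap.lsmul ℝ ℝ, volume] w) (x + h) -
        (ρ.normed volume ⋆[ContinuousLinearMap.lsmul ℝ ℝ, volume] w) x‖ₑ ^ p * f h ≤
      ∫⁻ x in Ω, ∫⁻ y in Ω, ‖w x - w y‖ₑ ^ p * f (x - y) := by
  have hρm : Measurable (ρ.normed (volume : Measure (EuclideanSpace ℝ (Fin d)))) :=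
    ρ.continuous_normed.measurable
  set Φ : EuclideanSpace ℝ (Fin d) → ℝ≥0∞ := fun y =>
    ∫⁻ h in Metric.ball 0 δ, ‖w (y + h) - w y‖ₑ ^ p * f h with hΦ
  have hΦm : Measurable Φ := by
    -- Since `f` is only almost everywhere measurable, it is replaced by a measurable version inside
    -- the integral. This makes `Φ` itself measurable, so that `Φ (x - t)` is jointly measurable.
    have heq : Φ = fun y => ∫⁻ h in Metric.ball 0 δ, ‖w (y + h) - w y‖ₑ ^ p * hf.mk f h := by
      funext y
      refine lintegral_congr_ae ?_
      filter_upwards [ae_restrict_of_ae hf.ae_eq_mk] with h hh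
      rw [hh]
    rw [heq]
    have := hf.measurable_mk
    exact Measurable.lintegral_prod_right' (f := fun z : EuclideanSpace ℝ (Fin d) ×
      EuclideanSpace ℝ (Fin d) => ‖w (z.1 + z.2) - w z.1‖ₑ ^ p * hf.mk f z.2) (by fun_prop)
  have hf' : AEMeasurable f (volume.restrict (Metric.ball 0 δ)) :=
    hf.mono_measure Measure.restrict_le_self
  have hinner : ∀ x, ∫⁻ h in Metric.ball 0 δ,
      ‖(ρ.normed volume ⋆[ContinuousLinearMap.lsmul ℝ ℝ, volume] w) (x + h) -
        (ρ.normed volume ⋆[ContinuousLinearMap.lsmul ℝ ℝ, volume] w) x‖ₑ ^ p * f h ≤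
      ∫⁻ t, ENNReal.ofReal (ρ.normed volume t) * Φ (x - t) := by
    intro x
    calc _ ≤ ∫⁻ h in Metric.ball 0 δ, ∫⁻ t, ENNReal.ofReal (ρ.normed volume t) *
          (‖w (x - t + h) - w (x - t)‖ₑ ^ p * f h) := by
          refine lintegral_mono fun h => ?_
          refine (mul_le_mul_left (enorm_convolution_sub_rpow_le hp ρ hw hwi x (x + h)) _).trans ?_
          rw [← lintegral_mul_const _ (by fun_prop)]
          refine le_of_eq (lintegral_congr fun t => ?_)
          rw [mul_assoc, sub_add_eq_add_sub]
      _ = ∫⁻ t, ∫⁻ h in Metric.ball 0 δ, ENNReal.ofReal (ρ.normed volume t) *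
          (‖w (x - t + h) - w (x - t)‖ₑ ^ p * f h) := by
          refine lintegral_lintegral_swap ?_
          have := hf'.comp_fst (ν := (volume : Measure (EuclideanSpace ℝ (Fin d))))
          refine AEMeasurable.mul (by fun_prop) (AEMeasurable.mul (by fun_prop) this)
      _ = _ := lintegral_congr fun t => lintegral_const_mul' _ _ ENNReal.ofReal_ne_top
  refine (lintegral_mono hinner).trans ?_
  rw [lintegral_lintegral_swap (by fun_prop)]
  have hone :
      ∫⁻ t, ENNReal.ofReal (ρ.normed (volume : Measure (EuclideanSpace ℝ (Fin d))) t) = 1 := by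
    rw [← ofReal_integral_eq_lintegral_ofReal ρ.integrable_normed
        (ae_of_all _ fun t => ρ.nonneg_normed t), ρ.integral_normed, ENNReal.ofReal_one]
  -- The bump has mass one, so the right side becomes an average over `t` and it suffices to compare
  -- the integrands for each `t`.
  rw [← one_mul (∫⁻ x in Ω, _), ← hone, ← lintegral_mul_const _ (by fun_prop)]
  refine lintegral_mono fun t => ?_
  simp only
  rw [lintegral_const_mul' _ _ ENNReal.ofReal_ne_top]
  by_cases ht : ρ.normed (volume : Measure (EuclideanSpace ℝ (Fin d))) t = 0
  · simp [ht]
  have ht' : ‖t‖ < ρ.rOut := by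
    have : t ∈ Function.support (ρ.normed (volume : Measure (EuclideanSpace ℝ (Fin d)))) := ht
    rw [ρ.support_normed_eq] at this
    simpa using this
  refine mul_le_mul_right ?_ _
  -- Translate by `t`. As `‖t‖ < ρ.rOut`, the margin `ρ.rOut + δ` around `x` leaves a margin `δ`
  -- around `x - t`.
  rw [← lintegral_indicator hΩ, ← lintegral_sub_right_eq_self (Ω.indicator _) t]
  refine le_trans (setLIntegral_mono' hVm fun x hx => ?_) (setLIntegral_le_lintegral V _)
  have hball : Metric.ball (x - t) δ ⊆ Ω := by
    refine subset_trans (Metric.ball_subset_ball' ?_) (hV x hx)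
    rw [dist_eq_norm, sub_sub_cancel_left, norm_neg]
    linarith
  rw [Set.indicator_of_mem (hball (Metric.mem_ball_self hδ))]
  exact setLIntegral_ball_increment_le hsymm w hball

theorem liminfEnergy_congr {d : ℕ} {p : ℝ} {ν : ℝ → EuclideanSpace ℝ (Fin d) → ℝ≥0∞}
    {Ω : Set (EuclideanSpace ℝ (Fin d))} {u w : EuclideanSpace ℝ (Fin d) → ℝ}
    (h : u =ᵐ[volume.restrict Ω] w) : liminfEnergy p ν Ω u = liminfEnergy p ν Ω w := by
  unfold liminfEnergy
  congr 1
  funext ε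
  refine lintegral_congr_ae ?_
  filter_upwards [h] with x hx
  refine lintegral_congr_ae ?_
  filter_upwards [h] with y hy
  rw [hx, hy]

theorem ContDiffBump.contDiff_normed_convolution {d : ℕ}
    (ρ : ContDiffBump (0 : EuclideanSpace ℝ (Fin d)))
    {w : EuclideanSpace ℝ (Fin d) → ℝ} (hwi : LocallyIntegrable w volume) :
    ContDiff ℝ ∞ (ρ.normed volume ⋆[ContinuousLinearMap.lsmul ℝ ℝ, volume] w) :=
  ρ.hasCompactSupport_normed.contDiff_convolution_left _ ρ.contDiff_normed hwi

/-- The local energy of a mollification is bounded by the limiting nonlocal energy. -/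
theorem IsDiracApproxPLevy.setLIntegral_fderiv_convolution_le {d : ℕ} {p : ℝ} (hp : 1 ≤ p)
    {ν : ℝ → EuclideanSpace ℝ (Fin d) → ℝ≥0∞} (hν : IsDiracApproxPLevy d p ν)
    {e : EuclideanSpace ℝ (Fin d)} (he : ‖e‖ = 1)
    (ρ : ContDiffBump (0 : EuclideanSpace ℝ (Fin d)))
    {w : EuclideanSpace ℝ (Fin d) → ℝ} (hw : Measurable w) (hwi : LocallyIntegrable w volume)
    {Ω V : Set (EuclideanSpace ℝ (Fin d))} (hΩ : MeasurableSet Ω) {δ : ℝ} (hδ : 0 < δ)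
    (hV : ∀ x ∈ V, Metric.ball x (ρ.rOut + δ) ⊆ Ω) (hVm : MeasurableSet V) :
    ENNReal.ofReal (sphereMean d p e) * ∫⁻ x in V,
      ‖fderiv ℝ (ρ.normed volume ⋆[ContinuousLinearMap.lsmul ℝ ℝ, volume] w) x‖ₑ ^ p ≤
      liminfEnergy p ν Ω w := by
  set v := ρ.normed volume ⋆[ContinuousLinearMap.lsmul ℝ ℝ, volume] w with hvdef
  have hv : ContDiff ℝ ∞ v := ρ.contDiff_normed_convolution hwi
  have hvm : Measurable v := hv.continuous.measurable
  -- Fatou's lemma asks for measurability at every `ε`, but `ν ε` is controlled only for `ε > 0`.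
  -- The value `0` elsewhere does not affect the liminf along `𝓝[>] 0`.
  let D : ℝ → EuclideanSpace ℝ (Fin d) → ℝ≥0∞ := fun ε x =>
    if 0 < ε then ∫⁻ h in Metric.ball 0 δ, ‖v (x + h) - v x‖ₑ ^ p * ν ε h else 0
  have hD : ∀ ε, AEMeasurable (D ε) (volume.restrict V) := by
    intro ε
    by_cases hε : 0 < ε
    · simp only [D, hε, if_true]
      have h1 : AEMeasurable (ν ε) (volume.restrict (Metric.ball 0 δ)) :=
        (hν.measurable ε hε).mono_measure Measure.restrict_le_self
      exact AEMeasurable.lintegral_prod_right' (f := fun z : EuclideanSpace ℝ (Fin d) ×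
        EuclideanSpace ℝ (Fin d) => ‖v (z.1 + z.2) - v z.1‖ₑ ^ p * ν ε z.2)
        (AEMeasurable.mul (by fun_prop) h1.comp_snd)
    · simp only [D, hε, if_false]
      exact aemeasurable_const
  calc _ = ∫⁻ x in V, ENNReal.ofReal (sphereMean d p e) * ‖fderiv ℝ v x‖ₑ ^ p :=
        (lintegral_const_mul' _ _ ENNReal.ofReal_ne_top).symm
    _ ≤ ∫⁻ x in V, liminf (fun ε => D ε x) (𝓝[>] 0) := by
        refine lintegral_mono fun x => ?_
        refine (hν.le_liminf_setLIntegral_ball hp he hvm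
          (hv.differentiable (by simp) x) hδ).trans (le_of_eq (liminf_congr ?_))
        filter_upwards [self_mem_nhdsWithin] with ε hε
        simp only [D, Set.mem_Ioi.1 hε, if_true]
    _ ≤ liminf (fun ε => ∫⁻ x in V, D ε x) (𝓝[>] 0) := lintegral_liminf_le' hD
    _ ≤ liminfEnergy p ν Ω w := by
        refine liminf_le_liminf ?_
        filter_upwards [self_mem_nhdsWithin] with ε hε
        simp only [D, Set.mem_Ioi.1 hε, if_true]
        exact setLIntegral_convolution_increment_le hp (hν.measurable ε hε)
          (fun h => hν.radial ε hε _ _ (norm_neg h)) ρ hw hwi hΩ hδ hV hVm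

/-! ### Functions with a weak gradient -/

/-- A sequence of smooth bumps at the origin with radii tending to `0`. -/
noncomputable def shrinkingBump (d n : ℕ) : ContDiffBump (0 : EuclideanSpace ℝ (Fin d)) :=
  -- The outer radius is twice the inner one; this bounded ratio is what almost everywhere
  -- convergence of the mollifications requires.
  ⟨1 / ((n : ℝ) + 1) / 2, 1 / ((n : ℝ) + 1), by positivity, half_lt_self (by positivity)⟩

theorem tendsto_shrinkingBump_rOut (d : ℕ) :
    Tendsto (fun n => (shrinkingBump d n).rOut) atTop (𝓝 0) :=
  tendsto_one_div_add_atTop_nhds_zero_nat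

/-- Extension by zero makes convolutions available on the whole space, and a Borel representative
gives the measurability of increments needed for Tonelli. -/
theorem exists_measurable_representative {d : ℕ} {p : ℝ} (hp : 1 ≤ p)
    {Ω : Set (EuclideanSpace ℝ (Fin d))} (hΩ : MeasurableSet Ω)
    {u : EuclideanSpace ℝ (Fin d) → ℝ} (hu : MemLp u (ENNReal.ofReal p) (volume.restrict Ω)) :
    ∃ w : EuclideanSpace ℝ (Fin d) → ℝ, Measurable w ∧ LocallyIntegrable w volume ∧
      w =ᵐ[volume] Ω.indicator u := by
  have h1 : MemLp (Ω.indicator u) (ENNReal.ofReal p) volume :=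
    (memLp_indicator_iff_restrict hΩ).2 hu
  refine ⟨h1.1.mk _, h1.1.stronglyMeasurable_mk.measurable, ?_, h1.1.ae_eq_mk.symm⟩
  exact (h1.locallyIntegrable (by simpa using hp)).congr h1.1.ae_eq_mk

theorem integral_mul_of_ae_eq_indicator {d : ℕ} {Ω : Set (EuclideanSpace ℝ (Fin d))}
    (hΩ : MeasurableSet Ω) {u w : EuclideanSpace ℝ (Fin d) → ℝ}
    (hwu : w =ᵐ[volume] Ω.indicator u) (ψ : EuclideanSpace ℝ (Fin d) → ℝ) :
    ∫ x, w x * ψ x = ∫ x in Ω, u x * ψ x := by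
  rw [← integral_indicator hΩ]
  refine integral_congr_ae ?_
  filter_upwards [hwu] with x hx
  simp only [hx, Set.indicator_mul_left]

theorem ae_restrict_eq_of_ae_eq_indicator {d : ℕ} {Ω : Set (EuclideanSpace ℝ (Fin d))}
    (hΩ : MeasurableSet Ω) {u w : EuclideanSpace ℝ (Fin d) → ℝ}
    (hwu : w =ᵐ[volume] Ω.indicator u) : u =ᵐ[volume.restrict Ω] w := by
  filter_upwards [ae_restrict_of_ae hwu, ae_restrict_mem hΩ] with x hx hxΩ
  rw [hx, Set.indicator_of_mem hxΩ]

theorem enorm_eq_of_apply_single_eq {d : ℕ} (ℓ : EuclideanSpace ℝ (Fin d) →L[ℝ] ℝ)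
    (a : EuclideanSpace ℝ (Fin d)) (h : ∀ i, ℓ (EuclideanSpace.single i 1) = a i) :
    ‖ℓ‖ₑ = ‖a‖ₑ := by
  have hℓ : ℓ = InnerProductSpace.toDual ℝ _ a := by
    refine ContinuousLinearMap.coe_injective
      ((EuclideanSpace.basisFun (Fin d) ℝ).toBasis.ext fun i => ?_)
    simp [h, EuclideanSpace.inner_single_right]
  rw [hℓ, ← ofReal_norm, ← ofReal_norm, LinearIsometryEquiv.norm_map]

/-- The derivative falls on the bump; passing from `x` to `y` in `ρ (x - y)` costs the sign. In this
form `w` is paired with the derivative of a test function, as in the definition of a weak gradient.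
-/
theorem fderiv_normed_convolution_apply {d : ℕ}
    (ρ : ContDiffBump (0 : EuclideanSpace ℝ (Fin d)))
    {w : EuclideanSpace ℝ (Fin d) → ℝ} (hwi : LocallyIntegrable w volume)
    (x z : EuclideanSpace ℝ (Fin d)) :
    fderiv ℝ (ρ.normed volume ⋆[ContinuousLinearMap.lsmul ℝ ℝ, volume] w) x z =
      -∫ y, w y * fderiv ℝ (fun y => ρ.normed volume (x - y)) y z := by
  have hρ : ContDiff ℝ 1 (ρ.normed (volume : Measure (EuclideanSpace ℝ (Fin d)))) :=
    ρ.contDiff_normed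
  have hc := ρ.hasCompactSupport_normed (μ := volume)
  rw [(hc.hasFDerivAt_convolution_left (ContinuousLinearMap.lsmul ℝ ℝ) hρ hwi x).fderiv,
    convolution_eq_swap, ContinuousLinearMap.integral_apply, ← integral_neg]
  · refine integral_congr_ae (ae_of_all _ fun y => ?_)
    have h1 : fderiv ℝ (fun y => ρ.normed volume (x - y)) y =
        -fderiv ℝ (ρ.normed volume) (x - y) := by
      have h2 := (hρ.differentiable one_ne_zero (x - y)).hasFDerivAt.comp y
        ((hasFDerivAt_id y).const_sub x)
      simpa [Function.comp_def] using h2.fderiv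
    simp [h1, mul_comm]
  · have h3 := (hc.fderiv ℝ).convolutionExists_left
      (ContinuousLinearMap.precompL (EuclideanSpace ℝ (Fin d)) (ContinuousLinearMap.lsmul ℝ ℝ))
      (hρ.continuous_fderiv one_ne_zero) hwi x
    exact (h3.integrable_swap : _)

/-- The derivative of a mollification is the mollification of the weak gradient. -/
theorem IsWeakGradient.fderiv_convolution_single {d : ℕ} {Ω : Set (EuclideanSpace ℝ (Fin d))}
    (hΩ : MeasurableSet Ω)
    {u w : EuclideanSpace ℝ (Fin d) → ℝ} (hwi : LocallyIntegrable w volume)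
    (hwu : w =ᵐ[volume] Ω.indicator u)
    {g : EuclideanSpace ℝ (Fin d) → EuclideanSpace ℝ (Fin d)} (hg : IsWeakGradient Ω u g)
    (ρ : ContDiffBump (0 : EuclideanSpace ℝ (Fin d))) {C : Set (EuclideanSpace ℝ (Fin d))}
    (hC : IsCompact C) (hCΩ : C ⊆ Ω) {x : EuclideanSpace ℝ (Fin d)}
    (hx : Metric.closedBall x ρ.rOut ⊆ C) (i : Fin d) :
    fderiv ℝ (ρ.normed volume ⋆[ContinuousLinearMap.lsmul ℝ ℝ, volume] w) x
        (EuclideanSpace.single i 1) =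
      (ρ.normed volume ⋆[ContinuousLinearMap.lsmul ℝ ℝ, volume] (C.indicator g)) x i := by
  have hgi : Integrable (C.indicator g) volume :=
    (integrable_indicator_iff hC.measurableSet).2
      ((hg.locallyIntegrableOn.mono_set hCΩ).integrableOn_isCompact hC)
  have htest : IsTestFunction Ω (fun y => ρ.normed volume (x - y)) := by
    have hsub : tsupport (fun y => ρ.normed volume (x - y)) ⊆ Metric.closedBall x ρ.rOut := by
      refine closure_minimal (fun y hy => ?_) Metric.isClosed_closedBall
      have : x - y ∈ Function.support (ρ.normed volume) := hy
      rw [ρ.support_normed_eq, mem_ball_zero_iff] at this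
      rw [Metric.mem_closedBall, dist_comm, dist_eq_norm]
      exact this.le
    refine ⟨ρ.contDiff_normed.comp (contDiff_const.sub contDiff_id), ?_,
      hsub.trans (hx.trans hCΩ)⟩
    exact (isCompact_closedBall x ρ.rOut).of_isClosed_subset (isClosed_tsupport _) hsub
  rw [fderiv_normed_convolution_apply ρ hwi, integral_mul_of_ae_eq_indicator hΩ hwu]
  have h1 := hg.integral_eq _ htest i
  simp only [partialDeriv] at h1
  rw [h1, neg_neg, convolution_eq_swap]
  have hint : Integrable (fun t => (ContinuousLinearMap.lsmul ℝ ℝ) (ρ.normed volume (x - t))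
      (C.indicator g t)) volume :=
    ((ρ.hasCompactSupport_normed (μ := volume)).convolutionExists_left
      (ContinuousLinearMap.lsmul ℝ ℝ) ρ.continuous_normed hgi.locallyIntegrable x).integrable_swap
  have h2 := (EuclideanSpace.proj (𝕜 := ℝ) i).integral_comp_comm hint
  refine Eq.trans ?_ h2
  rw [← integral_indicator hΩ]
  refine integral_congr_ae (ae_of_all _ fun y => ?_)
  -- Off `C` the bump centred at `x` vanishes, so cutting `g` off to `C` changes nothing.
  by_cases hyC : y ∈ C
  · simp [hyC, hCΩ hyC, mul_comm]
  · have h0 : ρ.normed volume (x - y) = 0 := by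
      by_contra hne
      have : x - y ∈ Function.support (ρ.normed volume) := hne
      rw [ρ.support_normed_eq, mem_ball_zero_iff] at this
      refine hyC (hx ?_)
      rw [Metric.mem_closedBall, dist_comm, dist_eq_norm]
      exact this.le
    simp [h0, hyC]

/-- On compact subsets, the local energy of a weak gradient is bounded by the limiting nonlocal
energy. -/
theorem IsWeakGradient.setLIntegral_compact_le {d : ℕ} {p : ℝ} (hp : 1 ≤ p)
    {ν : ℝ → EuclideanSpace ℝ (Fin d) → ℝ≥0∞} (hν : IsDiracApproxPLevy d p ν)
    {e : EuclideanSpace ℝ (Fin d)} (he : ‖e‖ = 1)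
    {Ω : Set (EuclideanSpace ℝ (Fin d))} (hΩ : IsOpen Ω)
    {u : EuclideanSpace ℝ (Fin d) → ℝ} (hu : MemLp u (ENNReal.ofReal p) (volume.restrict Ω))
    {g : EuclideanSpace ℝ (Fin d) → EuclideanSpace ℝ (Fin d)} (hg : IsWeakGradient Ω u g)
    {V : Set (EuclideanSpace ℝ (Fin d))} (hV : IsCompact V) (hVΩ : V ⊆ Ω) :
    ENNReal.ofReal (sphereMean d p e) * ∫⁻ x in V, ‖g x‖ₑ ^ p ≤ liminfEnergy p ν Ω u := by
  obtain ⟨w, hw, hwi, hwu⟩ := exists_measurable_representative hp hΩ.measurableSet hu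
  rw [liminfEnergy_congr (ae_restrict_eq_of_ae_eq_indicator hΩ.measurableSet hwu)]
  -- The margin `s` is split in half: mollification radii stay below `s / 2`, and the increments `h`
  -- range over a ball of radius `s / 2`.
  obtain ⟨s, hs, hsΩ⟩ := hV.exists_cthickening_subset_open hΩ hVΩ
  set C := Metric.cthickening s V with hCdef
  have hC : IsCompact C := hV.cthickening
  have hVC : ∀ x ∈ V, Metric.closedBall x s ⊆ C := fun x hx =>
    Metric.closedBall_subset_cthickening hx s
  have hgi : Integrable (C.indicator g) volume :=
    (integrable_indicator_iff hC.measurableSet).2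
      ((hg.locallyIntegrableOn.mono_set hsΩ).integrableOn_isCompact hC)
  have hev : ∀ᶠ n in atTop, (shrinkingBump d n).rOut < s / 2 :=
    (tendsto_shrinkingBump_rOut d).eventually_lt_const (half_pos hs)
  have hconv := ContDiffBump.ae_convolution_tendsto_right_of_locallyIntegrable (K := 2)
    (μ := volume) (tendsto_shrinkingBump_rOut d)
    (Eventually.of_forall fun n => le_of_eq (by simp [shrinkingBump]; ring))
    hgi.locallyIntegrable
  let v : ℕ → EuclideanSpace ℝ (Fin d) → ℝ := fun n =>
    (shrinkingBump d n).normed volume ⋆[ContinuousLinearMap.lsmul ℝ ℝ, volume] w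
  have hvc : ∀ n, Continuous (fderiv ℝ (v n)) := fun n =>
    ((shrinkingBump d n).contDiff_normed_convolution hwi).continuous_fderiv (by simp)
  have hlim : ∀ᵐ x ∂volume.restrict V,
      ‖g x‖ₑ ^ p = liminf (fun n => ‖fderiv ℝ (v n) x‖ₑ ^ p) atTop := by
    filter_upwards [ae_restrict_of_ae hconv, ae_restrict_mem hV.measurableSet] with x hx hxV
    rw [Set.indicator_of_mem (hVC x hxV (Metric.mem_closedBall_self hs.le))] at hx
    have h1 : Tendsto (fun n => ‖fderiv ℝ (v n) x‖ₑ ^ p) atTop (𝓝 (‖g x‖ₑ ^ p)) := by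
      refine ((ENNReal.continuous_rpow_const.tendsto _).comp hx.enorm).congr' ?_
      filter_upwards [hev] with n hn
      simp only [Function.comp]
      congr 1
      refine (enorm_eq_of_apply_single_eq _ _ fun i => ?_).symm
      exact hg.fderiv_convolution_single hΩ.measurableSet hwi hwu _ hC hsΩ
        ((Metric.closedBall_subset_closedBall (by linarith)).trans (hVC x hxV)) i
    exact h1.liminf_eq.symm
  rw [lintegral_congr_ae hlim]
  calc _ ≤ ENNReal.ofReal (sphereMean d p e) *
        liminf (fun n => ∫⁻ x in V, ‖fderiv ℝ (v n) x‖ₑ ^ p) atTop := by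
        refine mul_le_mul_right (lintegral_liminf_le fun n => ?_) _
        exact ((hvc n).enorm.measurable).pow_const p
    _ = liminf (fun n => ENNReal.ofReal (sphereMean d p e) *
          ∫⁻ x in V, ‖fderiv ℝ (v n) x‖ₑ ^ p) atTop :=
        (ENNReal.liminf_const_mul_of_ne_top ENNReal.ofReal_ne_top).symm
    _ ≤ liminf (fun _ : ℕ => liminfEnergy p ν Ω w) atTop := by
        refine liminf_le_liminf ?_
        filter_upwards [hev] with n hn
        refine hν.setLIntegral_fderiv_convolution_le hp he (shrinkingBump d n) hw hwi
          hΩ.measurableSet (half_pos hs) (fun x hx => ?_) hV.measurableSet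
        exact (Metric.ball_subset_closedBall.trans (Metric.closedBall_subset_closedBall
          (by linarith))).trans ((hVC x hx).trans hsΩ)
    _ = _ := liminf_const _

/-- The bound on compact subsets does not depend on the subset, so monotone convergence along a
compact exhaustion of `Ω` extends it. -/
theorem IsWeakGradient.setLIntegral_le {d : ℕ} {p : ℝ} (hp : 1 ≤ p)
    {ν : ℝ → EuclideanSpace ℝ (Fin d) → ℝ≥0∞} (hν : IsDiracApproxPLevy d p ν)
    {e : EuclideanSpace ℝ (Fin d)} (he : ‖e‖ = 1)
    {Ω : Set (EuclideanSpace ℝ (Fin d))} (hΩ : IsOpen Ω)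
    {u : EuclideanSpace ℝ (Fin d) → ℝ} (hu : MemLp u (ENNReal.ofReal p) (volume.restrict Ω))
    {g : EuclideanSpace ℝ (Fin d) → EuclideanSpace ℝ (Fin d)} (hg : IsWeakGradient Ω u g) :
    ENNReal.ofReal (sphereMean d p e) * ∫⁻ x in Ω, ‖g x‖ₑ ^ p ≤ liminfEnergy p ν Ω u := by
  obtain ⟨F, hFc, hFΩ, hFU, hFm⟩ := hΩ.exists_iUnion_isClosed
  have hunion : ⋃ n : ℕ, F n ∩ Metric.closedBall 0 n = Ω := by
    refine Set.Subset.antisymm (Set.iUnion_subset fun n => Set.inter_subset_left.trans (hFΩ n)) ?_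
    intro x hx
    rw [← hFU] at hx
    obtain ⟨m, hm⟩ := Set.mem_iUnion.1 hx
    obtain ⟨k, hk⟩ := exists_nat_ge ‖x‖
    refine Set.mem_iUnion.2 ⟨max m k, hFm (le_max_left _ _) hm, ?_⟩
    rw [mem_closedBall_zero_iff]
    exact hk.trans (by exact_mod_cast le_max_right _ _)
  have hmono : Monotone fun n : ℕ => F n ∩ Metric.closedBall 0 n := fun m n hmn =>
    Set.inter_subset_inter (hFm hmn) (Metric.closedBall_subset_closedBall (by exact_mod_cast hmn))
  rw [← hunion, setLIntegral_iUnion_of_directed _ hmono.directed_le, hunion, ENNReal.mul_iSup]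
  refine iSup_le fun n => ?_
  exact hg.setLIntegral_compact_le hp hν he hΩ hu
    ((isCompact_closedBall _ _).inter_left (hFc n)) (Set.inter_subset_left.trans (hFΩ n))

/-! ### Pairing with test fields and the total variation -/

/-- The pairing is a convolution with the reflected `ψ` evaluated at `0`, so associativity plays the
role of Fubini. The mollifier then acts on a continuous function, and convergence at one point
suffices. -/
theorem integral_normed_convolution_mul {d : ℕ}
    (ρ : ContDiffBump (0 : EuclideanSpace ℝ (Fin d)))
    {w : EuclideanSpace ℝ (Fin d) → ℝ} (hwi : LocallyIntegrable w volume)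
    {ψ : EuclideanSpace ℝ (Fin d) → ℝ} (hψ : Continuous ψ) (hψc : HasCompactSupport ψ) :
    ∫ x, (ρ.normed volume ⋆[ContinuousLinearMap.lsmul ℝ ℝ, volume] w) x * ψ x =
      (ρ.normed volume ⋆[ContinuousLinearMap.lsmul ℝ ℝ, volume]
        (w ⋆[ContinuousLinearMap.lsmul ℝ ℝ, volume] fun x => ψ (-x))) 0 := by
  have hk : Continuous fun x => ψ (-x) := hψ.comp continuous_neg
  have hkc : HasCompactSupport fun x => ψ (-x) := hψc.comp_homeomorph (Homeomorph.neg _)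
  have hρc := ρ.hasCompactSupport_normed (μ := volume)
  have hwn : LocallyIntegrable (fun x => ‖w x‖) volume := fun x => (hwi x).norm
  rw [← convolution_assoc (ContinuousLinearMap.lsmul ℝ ℝ) (ContinuousLinearMap.lsmul ℝ ℝ)
    (ContinuousLinearMap.lsmul ℝ ℝ) (ContinuousLinearMap.lsmul ℝ ℝ)]
  · simp [convolution_def]
  · intro x y z
    simp [mul_assoc]
  · exact ρ.continuous_normed.aestronglyMeasurable
  · exact hwi.aestronglyMeasurable
  · exact hk.aestronglyMeasurable
  · exact ae_of_all _ fun y => hρc.convolutionExists_left _ ρ.continuous_normed hwi y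
  · exact ae_of_all _ fun y => hkc.norm.convolutionExists_right _ hwn hk.norm y
  · exact hρc.norm.convolutionExists_left _ ρ.continuous_normed.norm
      (hkc.norm.continuous_convolution_right _ hwn hk.norm).locallyIntegrable _

theorem tendsto_integral_normed_convolution_mul {d : ℕ}
    {w : EuclideanSpace ℝ (Fin d) → ℝ} (hwi : LocallyIntegrable w volume)
    {ψ : EuclideanSpace ℝ (Fin d) → ℝ} (hψ : Continuous ψ) (hψc : HasCompactSupport ψ) :
    Tendsto (fun n => ∫ x, ((shrinkingBump d n).normed volume
      ⋆[ContinuousLinearMap.lsmul ℝ ℝ, volume] w) x * ψ x) atTop (𝓝 (∫ x, w x * ψ x)) := by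
  have hk : Continuous fun x => ψ (-x) := hψ.comp continuous_neg
  have hkc : HasCompactSupport fun x => ψ (-x) := hψc.comp_homeomorph (Homeomorph.neg _)
  simp_rw [integral_normed_convolution_mul _ hwi hψ hψc]
  have h := ContDiffBump.convolution_tendsto_right_of_continuous (μ := volume)
    (tendsto_shrinkingBump_rOut d)
    (hkc.continuous_convolution_right (ContinuousLinearMap.lsmul ℝ ℝ) hwi hk) 0
  simpa [convolution_def] using h

theorem IsTestFunction.coord {d : ℕ} {Ω : Set (EuclideanSpace ℝ (Fin d))}
    {φ : EuclideanSpace ℝ (Fin d) → EuclideanSpace ℝ (Fin d)} (hφ : IsTestFunction Ω φ)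
    (i : Fin d) : IsTestFunction Ω fun x => φ x i := by
  have hsub : tsupport (fun x => φ x i) ⊆ tsupport φ :=
    tsupport_comp_subset (g := fun y : EuclideanSpace ℝ (Fin d) => y i) rfl φ
  exact ⟨(EuclideanSpace.proj (𝕜 := ℝ) i).contDiff.comp hφ.smooth,
    hφ.hasCompactSupport.of_isClosed_subset (isClosed_tsupport _) hsub,
    hsub.trans hφ.tsupport_subset⟩

theorem IsTestFunction.continuous_partialDeriv {d : ℕ} {Ω : Set (EuclideanSpace ℝ (Fin d))}
    {φ : EuclideanSpace ℝ (Fin d) → ℝ} (hφ : IsTestFunction Ω φ) (i : Fin d) :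
    Continuous (partialDeriv i φ) :=
  (hφ.smooth.continuous_fderiv (by simp)).clm_apply continuous_const

theorem IsTestFunction.hasCompactSupport_partialDeriv {d : ℕ}
    {Ω : Set (EuclideanSpace ℝ (Fin d))}
    {φ : EuclideanSpace ℝ (Fin d) → ℝ} (hφ : IsTestFunction Ω φ) (i : Fin d) :
    HasCompactSupport (partialDeriv i φ) :=
  hφ.hasCompactSupport.fderiv_apply ℝ _

/-- Integration by parts in each coordinate; compact support of `φ` makes all products integrable
and removes boundary terms. -/
theorem IsTestFunction.integral_mul_divergence {d : ℕ} {Ω : Set (EuclideanSpace ℝ (Fin d))}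
    {φ : EuclideanSpace ℝ (Fin d) → EuclideanSpace ℝ (Fin d)} (hφ : IsTestFunction Ω φ)
    {v : EuclideanSpace ℝ (Fin d) → ℝ} (hv : ContDiff ℝ ∞ v) :
    ∫ x, v x * divergence φ x = -∫ x, fderiv ℝ v x (φ x) := by
  have hcomp : ∀ i, ∫ x, v x * partialDeriv i (fun y => φ y i) x =
      -∫ x, fderiv ℝ v x (EuclideanSpace.single i 1) * φ x i := by
    intro i
    have hi := hφ.coord i
    have hvc : Continuous fun x => fderiv ℝ v x (EuclideanSpace.single i 1) :=
      (hv.continuous_fderiv (by simp)).clm_apply continuous_const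
    refine integral_mul_fderiv_eq_neg_fderiv_mul_of_integrable ?_ ?_ ?_
      (fun x _ => hv.differentiable (by simp) x) (fun x _ => hi.smooth.differentiable (by simp) x)
    · exact (hvc.mul hi.smooth.continuous).integrable_of_hasCompactSupport
        hi.hasCompactSupport.mul_left
    · exact (hv.continuous.mul (hi.continuous_partialDeriv i)).integrable_of_hasCompactSupport
        (hi.hasCompactSupport_partialDeriv i).mul_left
    · exact (hv.continuous.mul hi.smooth.continuous).integrable_of_hasCompactSupport
        hi.hasCompactSupport.mul_left
  simp only [divergence, Finset.mul_sum]
  rw [integral_finsetSum _ fun i _ => ?_]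
  · simp_rw [hcomp]
    rw [Finset.sum_neg_distrib, ← integral_finsetSum _ fun i _ => ?_]
    · congr 1
      refine integral_congr_ae (ae_of_all _ fun x => ?_)
      have hx : φ x = ∑ i, φ x i • EuclideanSpace.single i (1 : ℝ) := by
        have := (EuclideanSpace.basisFun (Fin d) ℝ).sum_repr (φ x)
        simpa using this.symm
      simp only
      conv_rhs => rw [hx]
      simp [mul_comm]
    · have hi := hφ.coord i
      have hvc : Continuous fun x => fderiv ℝ v x (EuclideanSpace.single i 1) :=
        (hv.continuous_fderiv (by simp)).clm_apply continuous_const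
      exact (hvc.mul hi.smooth.continuous).integrable_of_hasCompactSupport
        hi.hasCompactSupport.mul_left
  · have hi := hφ.coord i
    exact (hv.continuous.mul (hi.continuous_partialDeriv i)).integrable_of_hasCompactSupport
      (hi.hasCompactSupport_partialDeriv i).mul_left

theorem IsTestFunction.ofReal_integral_mul_divergence_le {d : ℕ}
    {Ω : Set (EuclideanSpace ℝ (Fin d))}
    {φ : EuclideanSpace ℝ (Fin d) → EuclideanSpace ℝ (Fin d)} (hφ : IsTestFunction Ω φ)
    {v : EuclideanSpace ℝ (Fin d) → ℝ} (hv : ContDiff ℝ ∞ v) :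
    ENNReal.ofReal (∫ x, v x * divergence φ x) ≤
      ∫⁻ x in tsupport φ, ‖fderiv ℝ v x‖ₑ * ‖φ x‖ₑ := by
  rw [hφ.integral_mul_divergence hv]
  have hsupp : ∫ x, fderiv ℝ v x (φ x) = ∫ x in tsupport φ, fderiv ℝ v x (φ x) := by
    rw [setIntegral_eq_integral_of_forall_compl_eq_zero]
    intro x hx
    rw [image_eq_zero_of_notMem_tsupport hx, map_zero]
  rw [hsupp]
  refine (Real.ofReal_le_enorm _).trans ?_
  rw [enorm_neg]
  refine (enorm_integral_le_lintegral_enorm _).trans (lintegral_mono fun x => ?_)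
  exact ContinuousLinearMap.le_opENorm _ _

theorem IsTestFunction.continuous_divergence {d : ℕ} {Ω : Set (EuclideanSpace ℝ (Fin d))}
    {φ : EuclideanSpace ℝ (Fin d) → EuclideanSpace ℝ (Fin d)} (hφ : IsTestFunction Ω φ) :
    Continuous (divergence φ) :=
  continuous_finsetSum _ fun i _ => (hφ.coord i).continuous_partialDeriv i

theorem IsTestFunction.hasCompactSupport_divergence {d : ℕ} {Ω : Set (EuclideanSpace ℝ (Fin d))}
    {φ : EuclideanSpace ℝ (Fin d) → EuclideanSpace ℝ (Fin d)} (hφ : IsTestFunction Ω φ) :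
    HasCompactSupport (divergence φ) := by
  refine HasCompactSupport.intro hφ.hasCompactSupport fun x hx => ?_
  refine Finset.sum_eq_zero fun i _ => ?_
  have hsub : tsupport (fun x => φ x i) ⊆ tsupport φ :=
    tsupport_comp_subset (g := fun y : EuclideanSpace ℝ (Fin d) => y i) rfl φ
  have h0 : fderiv ℝ (fun y => φ y i) x = 0 :=
    image_eq_zero_of_notMem_tsupport fun h => hx (hsub (tsupport_fderiv_subset ℝ h))
  rw [partialDeriv, h0, zero_apply]

/-- If the local energies of the mollifications of `u` control the pairing with `φ`, so does the
limiting nonlocal energy. -/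
theorem IsDiracApproxPLevy.ofReal_integral_mul_divergence_le {d : ℕ} {p : ℝ} (hp : 1 ≤ p)
    {ν : ℝ → EuclideanSpace ℝ (Fin d) → ℝ≥0∞} (hν : IsDiracApproxPLevy d p ν)
    {e : EuclideanSpace ℝ (Fin d)} (he : ‖e‖ = 1)
    {Ω : Set (EuclideanSpace ℝ (Fin d))} (hΩ : IsOpen Ω)
    {u : EuclideanSpace ℝ (Fin d) → ℝ} (hu : MemLp u (ENNReal.ofReal p) (volume.restrict Ω))
    {φ : EuclideanSpace ℝ (Fin d) → EuclideanSpace ℝ (Fin d)} (hφ : IsTestFunction Ω φ)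
    {N : ℝ≥0∞}
    (hN : ∀ ℓ : EuclideanSpace ℝ (Fin d) → EuclideanSpace ℝ (Fin d) →L[ℝ] ℝ, Continuous ℓ →
      ∫⁻ x in tsupport φ, ‖ℓ x‖ₑ * ‖φ x‖ₑ ≤ (∫⁻ x in tsupport φ, ‖ℓ x‖ₑ ^ p) ^ (1 / p) * N) :
    ENNReal.ofReal (sphereMean d p e) ^ (1 / p) *
      ENNReal.ofReal (∫ x in Ω, u x * divergence φ x) ≤ liminfEnergy p ν Ω u ^ (1 / p) * N := by
  have hp0 : 0 < p := one_pos.trans_le hp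
  obtain ⟨w, hw, hwi, hwu⟩ := exists_measurable_representative hp hΩ.measurableSet hu
  rw [liminfEnergy_congr (ae_restrict_eq_of_ae_eq_indicator hΩ.measurableSet hwu),
    ← integral_mul_of_ae_eq_indicator hΩ.measurableSet hwu]
  obtain ⟨s, hs, hsΩ⟩ := IsCompact.exists_cthickening_subset_open
    (hφ.hasCompactSupport : IsCompact (tsupport φ)) hΩ hφ.tsupport_subset
  have hev : ∀ᶠ n in atTop, (shrinkingBump d n).rOut < s / 2 :=
    (tendsto_shrinkingBump_rOut d).eventually_lt_const (half_pos hs)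
  have hlim := ENNReal.Tendsto.const_mul (a := ENNReal.ofReal (sphereMean d p e) ^ (1 / p))
    (ENNReal.tendsto_ofReal (tendsto_integral_normed_convolution_mul hwi
    hφ.continuous_divergence hφ.hasCompactSupport_divergence))
    (Or.inr (ENNReal.rpow_ne_top_of_nonneg (by positivity) ENNReal.ofReal_ne_top))
  refine le_of_tendsto hlim ?_
  filter_upwards [hev] with n hn
  have hsm := (shrinkingBump d n).contDiff_normed_convolution hwi
  have henergy := hν.setLIntegral_fderiv_convolution_le hp he (shrinkingBump d n) hw hwi
    (V := tsupport φ) hΩ.measurableSet (half_pos hs) (fun x hx =>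
      (Metric.ball_subset_closedBall.trans (Metric.closedBall_subset_closedBall
        (by linarith))).trans ((Metric.closedBall_subset_cthickening hx s).trans hsΩ))
    (isClosed_tsupport _).measurableSet
  calc _ ≤ ENNReal.ofReal (sphereMean d p e) ^ (1 / p) * ((∫⁻ x in tsupport φ,
        ‖fderiv ℝ ((shrinkingBump d n).normed volume
          ⋆[ContinuousLinearMap.lsmul ℝ ℝ, volume] w) x‖ₑ ^ p) ^ (1 / p) * N) :=
        mul_le_mul_right ((hφ.ofReal_integral_mul_divergence_le hsm).trans
          (hN _ (hsm.continuous_fderiv (by simp)))) _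
    _ ≤ _ := by
        rw [← mul_assoc, ← ENNReal.mul_rpow_of_nonneg _ _ (by positivity)]
        exact mul_le_mul_left (ENNReal.rpow_le_rpow henergy (by positivity)) _

/-- For `p = 1` the pointwise bound `|φ| ≤ 1` takes the place of Hölder's inequality, with constant
`N = 1`. -/
theorem IsDiracApproxPLevy.mul_bvSeminorm_le {d : ℕ}
    {ν : ℝ → EuclideanSpace ℝ (Fin d) → ℝ≥0∞} (hν : IsDiracApproxPLevy d 1 ν)
    {e : EuclideanSpace ℝ (Fin d)} (he : ‖e‖ = 1)
    {Ω : Set (EuclideanSpace ℝ (Fin d))} (hΩ : IsOpen Ω)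
    {u : EuclideanSpace ℝ (Fin d) → ℝ} (hu : MemLp u 1 (volume.restrict Ω)) :
    ENNReal.ofReal (sphereMean d 1 e) * bvSeminorm Ω u ≤ liminfEnergy 1 ν Ω u := by
  simp only [bvSeminorm, ENNReal.mul_iSup]
  refine iSup_le fun φ => iSup_le fun hφ => iSup_le fun hb => ?_
  have h := hν.ofReal_integral_mul_divergence_le le_rfl he hΩ (by simpa using hu) hφ (N := 1)
    (fun ℓ _ => by
      simp only [ENNReal.rpow_one, one_div, inv_one, mul_one]
      refine lintegral_mono fun x => mul_le_of_le_one_right' ?_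
      rw [← ofReal_norm]
      exact ENNReal.ofReal_le_one.2 (hb x))
  simpa using h

/-! ### Functionals on `L^q` -/

/-- Hahn–Banach: a functional which is bounded along a linear map `T` factors through a continuous
functional on the target of `T`. -/
theorem exists_dual_comp_eq {X F : Type*} [AddCommGroup X] [Module ℝ X] [NormedAddCommGroup F]
    [NormedSpace ℝ F] (T : X →ₗ[ℝ] F) (ℓ : X →ₗ[ℝ] ℝ) (C : ℝ) (h : ∀ x, ‖ℓ x‖ ≤ C * ‖T x‖) :
    ∃ L : F →L[ℝ] ℝ, ∀ x, L (T x) = ℓ x := by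
  -- The bound makes `ℓ` vanish on the kernel of `T`, so it descends to the range of `T`, where it
  -- is bounded by `C`.
  have hker : T.ker ≤ ℓ.ker := by
    intro x hx
    have h1 := h x
    rw [LinearMap.mem_ker.1 hx, norm_zero, mul_zero] at h1
    exact norm_le_zero_iff.1 h1
  let f : T.range →ₗ[ℝ] ℝ := (T.ker.liftQ ℓ hker) ∘ₗ T.quotKerEquivRange.symm.toLinearMap
  have hf : ∀ x, f ⟨T x, LinearMap.mem_range_self T x⟩ = ℓ x := by
    intro x
    have : T.quotKerEquivRange.symm ⟨T x, LinearMap.mem_range_self T x⟩ = T.ker.mkQ x :=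
      T.quotKerEquivRange_symm_apply_image x (LinearMap.mem_range_self T x)
    simp [f, this]
  let fc : StrongDual ℝ T.range := f.mkContinuous C (by
    rintro ⟨_, x, rfl⟩
    rw [hf]
    exact h x)
  obtain ⟨L, hL, -⟩ := exists_extension_norm_eq T.range fc
  exact ⟨L, fun x => (hL ⟨T x, LinearMap.mem_range_self T x⟩).trans (hf x)⟩

section LpDual

variable {α : Type*} [MeasurableSpace α] {μ : Measure α} {q : ℝ≥0∞}

/-- Dominated convergence in `L^q`. -/
theorem tendsto_toLp_of_dominated [Fact (1 ≤ q)] (hq : q ≠ ⊤) {ι : Type*}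
    {l : Filter ι} [l.IsCountablyGenerated] {F : ι → α → ℝ} {f G : α → ℝ}
    (hFm : ∀ n, Measurable (F n)) (hfm : Measurable f)
    (hF : ∀ n, MemLp (F n) q μ) (hf : MemLp f q μ) (hG : MemLp G q μ)
    (hFG : ∀ n x, ‖F n x‖ ≤ ‖G x‖) (hfG : ∀ x, ‖f x‖ ≤ ‖G x‖)
    (hlim : ∀ x, Tendsto (fun n => F n x) l (𝓝 (f x))) :
    Tendsto (fun n => (hF n).toLp (F n)) l (𝓝 (hf.toLp f)) := by
  have hq1 : 1 ≤ q := Fact.out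
  have hq0 : q ≠ 0 := (one_pos.trans_le hq1).ne'
  have hqr : 0 < q.toReal := ENNReal.toReal_pos hq0 hq
  rw [Lp.tendsto_Lp_iff_tendsto_eLpNorm'']
  simp_rw [eLpNorm_eq_lintegral_rpow_enorm_toReal hq0 hq]
  have hz : (0 : ℝ≥0∞) = (∫⁻ _, 0 ∂μ) ^ (1 / q.toReal) := by
    simp [hqr]
  rw [hz]
  refine (ENNReal.continuous_rpow_const.tendsto _).comp ?_
  refine tendsto_lintegral_filter_of_dominated_convergence (fun x => ‖(2 * G x)‖ₑ ^ q.toReal)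
    (Eventually.of_forall fun n => ?_) (Eventually.of_forall fun n => ae_of_all _ fun x => ?_) ?_
    (ae_of_all _ fun x => ?_)
  · exact (((hFm n).sub hfm).enorm).pow_const _
  · refine ENNReal.rpow_le_rpow ?_ hqr.le
    rw [enorm_le_iff_norm_le]
    refine (norm_sub_le _ _).trans ?_
    rw [norm_mul, Real.norm_ofNat]
    linarith [hFG n x, hfG x]
  · exact (lintegral_rpow_enorm_lt_top_of_eLpNorm_lt_top hq0 hq (hG.const_mul 2).2).ne
  · have h1 := ((hlim x).sub_const (f x)).enorm
    rw [sub_self, enorm_zero] at h1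
    have h2 := (ENNReal.continuous_rpow_const (y := q.toReal)).tendsto 0 |>.comp h1
    simpa [ENNReal.zero_rpow_of_pos hqr, Function.comp_def] using h2

theorem toLp_eq_zero_of_ae_eq_zero {f : α → ℝ} (hf : MemLp f q μ) (h : f =ᵐ[μ] 0) :
    hf.toLp f = 0 :=
  (Lp.eq_zero_iff_ae_eq_zero).2 (hf.coeFn_toLp.trans h)

open Classical in
/-- The signed measure `S ↦ L (1_S w)` associated with a functional `L` on `L^q`. -/
noncomputable def dualSignedMeasure [Fact (1 ≤ q)] (hq : q ≠ ⊤) {w : α → ℝ} (hwm : Measurable w)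
    (hw : MemLp w q μ) (L : Lp ℝ q μ →L[ℝ] ℝ) : SignedMeasure α where
  measureOf' S := if h : MeasurableSet S then L ((hw.indicator h).toLp (S.indicator w)) else 0
  empty' := by
    rw [dif_pos MeasurableSet.empty]
    rw [toLp_eq_zero_of_ae_eq_zero _ (ae_of_all _ fun x => by simp), map_zero]
  not_measurable' S hS := dif_neg hS
  m_iUnion' f hf hdisj := by
    have hfin : ∀ s : Finset ℕ, MeasurableSet (⋃ i ∈ s, f i) := fun s =>
      s.measurableSet_biUnion fun i _ => hf i
    have hsum : ∀ s : Finset ℕ, ∑ i ∈ s, L ((hw.indicator (hf i)).toLp ((f i).indicator w)) =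
        L ((hw.indicator (hfin s)).toLp ((⋃ i ∈ s, f i).indicator w)) := by
      intro s
      induction s using Finset.induction_on with
      | empty =>
        rw [Finset.sum_empty]
        symm
        convert map_zero L
        exact toLp_eq_zero_of_ae_eq_zero _ (ae_of_all _ fun x => by simp)
      | insert a s ha ih =>
        rw [Finset.sum_insert ha, ih, ← map_add, ← MemLp.toLp_add]
        congr 1
        refine MemLp.toLp_congr _ _ (ae_of_all _ fun x => ?_)
        rw [Finset.set_biUnion_insert, Set.indicator_union_of_disjoint]
        · rfl
        · rw [Set.disjoint_iUnion₂_right]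
          intro i hi
          exact hdisj fun h => ha (h ▸ hi)
    simp only [dif_pos (hf _), dif_pos (MeasurableSet.iUnion hf)]
    -- Countable additivity is a limit along finite subsets of `ℕ`, obtained from dominated
    -- convergence in `L^q` with `w` dominating every indicator.
    simp only [HasSum, SummationFilter.unconditional_filter]
    simp_rw [hsum]
    refine (L.continuous.tendsto _).comp ?_
    refine tendsto_toLp_of_dominated hq (fun s => hwm.indicator (hfin s))
      (hwm.indicator (MeasurableSet.iUnion hf)) _ _ hw
      (fun s x => norm_indicator_le_norm_self _ _) (fun x => norm_indicator_le_norm_self _ _)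
      fun x => ?_
    by_cases hx : x ∈ ⋃ i, f i
    · obtain ⟨j, hj⟩ := Set.mem_iUnion.1 hx
      refine tendsto_const_nhds.congr' ?_
      filter_upwards [eventually_ge_atTop {j}] with s hs
      rw [Set.indicator_of_mem hx, Set.indicator_of_mem]
      exact Set.mem_biUnion (Finset.singleton_subset_iff.1 hs) hj
    · refine tendsto_const_nhds.congr fun s => ?_
      rw [Set.indicator_of_notMem hx, Set.indicator_of_notMem]
      exact fun h => hx (Set.iUnion₂_subset_iUnion _ _ h)

theorem dualSignedMeasure_apply [Fact (1 ≤ q)] (hq : q ≠ ⊤) {w : α → ℝ} (hwm : Measurable w)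
    (hw : MemLp w q μ) (L : Lp ℝ q μ →L[ℝ] ℝ) {S : Set α} (hS : MeasurableSet S) :
    dualSignedMeasure hq hwm hw L S = L ((hw.indicator hS).toLp (S.indicator w)) :=
  dif_pos hS

/-- A continuous functional on `L^q`, `1 ≤ q < ∞`, is given by an integrable density relative to a
fixed weight `w ∈ L^q`. -/
theorem exists_integrable_dual_density [SigmaFinite μ] [Fact (1 ≤ q)] (hq : q ≠ ⊤) {w : α → ℝ}
    (hwm : Measurable w) (hw : MemLp w q μ) (L : Lp ℝ q μ →L[ℝ] ℝ) :
    ∃ g : α → ℝ, Integrable g μ ∧ ∀ s : α → ℝ, Measurable s → (∃ c, ∀ x, ‖s x‖ ≤ c) →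
      ∀ hs : MemLp (fun x => s x * w x) q μ, L (hs.toLp _) = ∫ x, s x * g x ∂μ := by
  set m := dualSignedMeasure hq hwm hw L with hm
  have hac : m ≪ᵥ μ.toENNRealVectorMeasure := by
    refine VectorMeasure.AbsolutelyContinuous.mk fun S hS h0 => ?_
    rw [Measure.toENNRealVectorMeasure_apply_measurable hS] at h0
    rw [hm, dualSignedMeasure_apply hq hwm hw L hS]
    convert map_zero L
    exact toLp_eq_zero_of_ae_eq_zero _ (indicator_meas_zero h0)
  -- Radon–Nikodym supplies the density. The weight `w` ensures that even sets of infinite measure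
  -- have a value under `m`.
  have hgi := m.integrable_rnDeriv μ
  set g := m.rnDeriv μ with hg
  have hset : ∀ {S : Set α} (hS : MeasurableSet S),
      L ((hw.indicator hS).toLp (S.indicator w)) = ∫ x in S, g x ∂μ := by
    intro S hS
    rw [← dualSignedMeasure_apply hq hwm hw L hS, ← withDensityᵥ_apply hgi hS,
      m.withDensityᵥ_rnDeriv_eq μ hac]
  have hmem : ∀ s : α → ℝ, Measurable s → (∃ c, ∀ x, ‖s x‖ ≤ c) →
      MemLp (fun x => s x * w x) q μ := by
    rintro s hs ⟨c, hc⟩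
    refine (hw.const_mul c).mono (hs.mul hwm).aestronglyMeasurable (ae_of_all _ fun x => ?_)
    rw [norm_mul, norm_mul]
    exact mul_le_mul_of_nonneg_right ((hc x).trans (Real.le_norm_self c)) (norm_nonneg _)
  have hsimple : ∀ s : SimpleFunc α ℝ, ∀ hs : MemLp (fun x => s x * w x) q μ,
      L (hs.toLp _) = ∫ x, s x * g x ∂μ := by
    intro s
    induction s using SimpleFunc.induction with
    | @const c S hS =>
      intro hs
      have h1 : hs.toLp _ = c • (hw.indicator hS).toLp (S.indicator w) := by
        rw [← MemLp.toLp_const_smul]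
        refine MemLp.toLp_congr _ _ (ae_of_all _ fun x => ?_)
        by_cases hx : x ∈ S <;> simp [hx]
      rw [h1, map_smul, hset hS, smul_eq_mul, ← integral_const_mul, ← integral_indicator hS]
      refine integral_congr_ae (ae_of_all _ fun x => ?_)
      by_cases hx : x ∈ S <;> simp [hx]
    | @add s t _ ihs iht =>
      intro hst
      have hs := hmem s s.measurable s.exists_forall_norm_le
      have ht := hmem t t.measurable t.exists_forall_norm_le
      have h1 : hst.toLp _ = hs.toLp _ + ht.toLp _ := by
        rw [← MemLp.toLp_add]
        refine MemLp.toLp_congr _ _ (ae_of_all _ fun x => ?_)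
        simp [add_mul]
      obtain ⟨c, hc⟩ := s.exists_forall_norm_le
      obtain ⟨c', hc'⟩ := t.exists_forall_norm_le
      rw [h1, map_add, ihs, iht, ← integral_add
        (hgi.bdd_mul s.measurable.aestronglyMeasurable (ae_of_all _ hc))
        (hgi.bdd_mul t.measurable.aestronglyMeasurable (ae_of_all _ hc'))]
      simp [add_mul]
  refine ⟨g, hgi, fun s hsm hb hs => ?_⟩
  obtain ⟨c, hc⟩ := hb
  have hc' : ∀ x, ‖s x‖ ≤ |c| := fun x => (hc x).trans (le_abs_self c)
  have hss := hsm.stronglyMeasurable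
  -- Simple functions bounded by `|c|` converge to `s` pointwise. Both sides pass to the limit,
  -- dominated by `c w` in `L^q` and by `|c| |g|` in `L^1`.
  have hbd := hss.norm_approxBounded_le (abs_nonneg c)
  have hmem' : ∀ n, MemLp (fun x => hss.approxBounded |c| n x * w x) q μ := fun n =>
    hmem _ (hss.approxBounded |c| n).measurable ⟨|c|, hbd n⟩
  have hlim1 := tendsto_toLp_of_dominated hq
    (fun n => (hss.approxBounded |c| n).measurable.mul hwm) (hsm.mul hwm) hmem' hs
    (hw.const_mul c)
    (fun n x => by
      simp only [norm_mul, Pi.mul_apply]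
      exact mul_le_mul_of_nonneg_right (hbd n x) (norm_nonneg _))
    (fun x => by
      simp only [norm_mul, Pi.mul_apply]
      exact mul_le_mul_of_nonneg_right (hc' x) (norm_nonneg _))
    (fun x => (hss.tendsto_approxBounded_of_norm_le (hc' x)).mul_const (w x))
  have hlim2 : Tendsto (fun n => ∫ x, hss.approxBounded |c| n x * g x ∂μ) atTop
      (𝓝 (∫ x, s x * g x ∂μ)) := by
    refine tendsto_integral_of_dominated_convergence (fun x => |c| * ‖g x‖) (fun n => ?_)
      (hgi.norm.const_mul _) (fun n => ae_of_all _ fun x => ?_) (ae_of_all _ fun x => ?_)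
    · exact (hss.approxBounded |c| n).measurable.aestronglyMeasurable.mul hgi.1
    · rw [norm_mul]
      exact mul_le_mul_of_nonneg_right (hbd n x) (norm_nonneg _)
    · exact (hss.tendsto_approxBounded_of_norm_le (hc' x)).mul_const (g x)
  refine tendsto_nhds_unique ((L.continuous.tendsto _).comp hlim1) (hlim2.congr fun n => ?_)
  exact (hsimple _ (hmem' n)).symm

end LpDual

/-! ### Existence of a weak gradient for `p > 1` -/

/-- The space `C_c^∞(Ω)` of real test functions. -/
def testFunctionSubmodule {d : ℕ} (Ω : Set (EuclideanSpace ℝ (Fin d))) :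
    Submodule ℝ (EuclideanSpace ℝ (Fin d) → ℝ) where
  carrier := {φ | IsTestFunction Ω φ}
  add_mem' {φ ψ} hφ hψ := ⟨hφ.smooth.add hψ.smooth, hφ.hasCompactSupport.add hψ.hasCompactSupport,
    (tsupport_add φ ψ).trans (Set.union_subset hφ.tsupport_subset hψ.tsupport_subset)⟩
  zero_mem' := ⟨contDiff_const, HasCompactSupport.zero, by simp [tsupport]⟩
  smul_mem' c φ hφ := by
    have hsub : tsupport (c • φ) ⊆ tsupport φ :=
      closure_mono (Function.support_const_smul_subset c φ)
    exact ⟨contDiff_const.smul hφ.smooth,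
      hφ.hasCompactSupport.of_isClosed_subset (isClosed_tsupport _) hsub,
      hsub.trans hφ.tsupport_subset⟩

theorem IsTestFunction.memLp {d : ℕ} {Ω : Set (EuclideanSpace ℝ (Fin d))}
    {φ : EuclideanSpace ℝ (Fin d) → ℝ} (hφ : IsTestFunction Ω φ) (q : ℝ≥0∞)
    (S : Set (EuclideanSpace ℝ (Fin d))) :
    MemLp φ q (volume.restrict S) :=
  (hφ.smooth.continuous.memLp_of_hasCompactSupport hφ.hasCompactSupport).restrict S

theorem IsTestFunction.integrable_mul_partialDeriv {d : ℕ} {p : ℝ} (hp : 1 ≤ p)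
    {Ω : Set (EuclideanSpace ℝ (Fin d))}
    {u : EuclideanSpace ℝ (Fin d) → ℝ} (hu : MemLp u (ENNReal.ofReal p) (volume.restrict Ω))
    {φ : EuclideanSpace ℝ (Fin d) → ℝ} (hφ : IsTestFunction Ω φ) (i : Fin d) :
    Integrable (fun x => u x * partialDeriv i φ x) (volume.restrict Ω) := by
  have h := (hu.locallyIntegrable (by simpa using hp)).integrable_smul_left_of_hasCompactSupport
    (hφ.continuous_partialDeriv i) (hφ.hasCompactSupport_partialDeriv i)
  simpa [mul_comm] using h

theorem IsTestFunction.smul_single {d : ℕ} {Ω : Set (EuclideanSpace ℝ (Fin d))}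
    {φ : EuclideanSpace ℝ (Fin d) → ℝ} (hφ : IsTestFunction Ω φ) (i : Fin d) :
    IsTestFunction Ω fun x => φ x • EuclideanSpace.single i (1 : ℝ) := by
  have hsub : tsupport (fun x => φ x • EuclideanSpace.single i (1 : ℝ)) ⊆ tsupport φ :=
    tsupport_comp_subset (g := fun y : ℝ => y • EuclideanSpace.single i (1 : ℝ)) (by simp) φ
  exact ⟨hφ.smooth.smul contDiff_const,
    hφ.hasCompactSupport.of_isClosed_subset (isClosed_tsupport _) hsub,
    hsub.trans hφ.tsupport_subset⟩

theorem divergence_smul_single {d : ℕ} (φ : EuclideanSpace ℝ (Fin d) → ℝ) (i : Fin d) :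
    divergence (fun x => φ x • EuclideanSpace.single i (1 : ℝ)) = partialDeriv i φ := by
  funext x
  rw [divergence, Finset.sum_eq_single i]
  · simp
  · intro j _ hj
    simp [partialDeriv, hj]
  · simp

/-- Finiteness of the limiting nonlocal energy bounds the distributional derivative of `u` in the
dual of `L^q`. -/
theorem IsDiracApproxPLevy.exists_abs_integral_mul_partialDeriv_le {d : ℕ} {p q : ℝ}
    (hpq : p.HolderConjugate q)
    {ν : ℝ → EuclideanSpace ℝ (Fin d) → ℝ≥0∞} (hν : IsDiracApproxPLevy d p ν)
    {e : EuclideanSpace ℝ (Fin d)} (he : ‖e‖ = 1)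
    {Ω : Set (EuclideanSpace ℝ (Fin d))} (hΩ : IsOpen Ω)
    {u : EuclideanSpace ℝ (Fin d) → ℝ} (hu : MemLp u (ENNReal.ofReal p) (volume.restrict Ω))
    (hA : liminfEnergy p ν Ω u ≠ ⊤) :
    ∃ C : ℝ, ∀ φ : EuclideanSpace ℝ (Fin d) → ℝ, IsTestFunction Ω φ → ∀ i : Fin d,
      |∫ x in Ω, u x * partialDeriv i φ x| ≤
        C * (eLpNorm φ (ENNReal.ofReal q) (volume.restrict Ω)).toReal := by
  have hp : 1 ≤ p := hpq.lt.le
  have hq0 : 0 < q := hpq.symm.pos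
  have hip : 0 ≤ 1 / p := by positivity
  set κ := ENNReal.ofReal (sphereMean d p e) ^ (1 / p) with hκ
  have hκ0 : κ ≠ 0 := by
    have := sphereMean_pos hpq.pos he
    simp [hκ, ENNReal.rpow_eq_zero_iff, this]
  have hκt : κ ≠ ⊤ := ENNReal.rpow_ne_top_of_nonneg hip ENNReal.ofReal_ne_top
  have hB : liminfEnergy p ν Ω u ^ (1 / p) ≠ ⊤ := ENNReal.rpow_ne_top_of_nonneg hip hA
  have key : ∀ φ : EuclideanSpace ℝ (Fin d) → ℝ, IsTestFunction Ω φ → ∀ i : Fin d,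
      ∫ x in Ω, u x * partialDeriv i φ x ≤ (liminfEnergy p ν Ω u ^ (1 / p) / κ).toReal *
        (eLpNorm φ (ENNReal.ofReal q) (volume.restrict Ω)).toReal := by
    intro φ hφ i
    set N := eLpNorm φ (ENNReal.ofReal q) (volume.restrict Ω) with hN
    have hNt : N ≠ ⊤ := (hφ.memLp _ Ω).2.ne
    -- The field `φ e_i` has divergence `∂_i φ` and norm `|φ|`, so Hölder's inequality gives the
    -- pairing bound with `N` the `L^q` norm of `φ`.
    have hφi := hφ.smul_single i
    have h := hν.ofReal_integral_mul_divergence_le hp he hΩ hu hφi (N := N) (by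
      intro ℓ hℓ
      refine (ENNReal.lintegral_mul_le_Lp_mul_Lq _ hpq hℓ.enorm.measurable.aemeasurable
        hφi.smooth.continuous.enorm.measurable.aemeasurable).trans ?_
      refine mul_le_mul_right ?_ _
      rw [hN, eLpNorm_eq_lintegral_rpow_enorm_toReal (by simpa using hq0) ENNReal.ofReal_ne_top,
        ENNReal.toReal_ofReal hq0.le]
      refine ENNReal.rpow_le_rpow ?_ (by positivity)
      refine (lintegral_mono_set hφi.tsupport_subset).trans (lintegral_mono fun x => ?_)
      refine ENNReal.rpow_le_rpow ?_ hq0.le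
      rw [enorm_le_iff_norm_le]
      simp [norm_smul])
    rw [divergence_smul_single] at h
    rw [← ENNReal.toReal_mul]
    refine (ENNReal.ofReal_le_iff_le_toReal
      (ENNReal.mul_ne_top (ENNReal.div_ne_top hB hκ0) hNt)).1 ?_
    rw [ENNReal.mul_div_right_comm.symm, ENNReal.le_div_iff_mul_le (Or.inl hκ0) (Or.inl hκt),
      mul_comm]
    exact h
  refine ⟨_, fun φ hφ i => abs_le'.2 ⟨key φ hφ i, ?_⟩⟩
  -- The one-sided bound applied to `-φ` gives the other half of the absolute value.
  have hneg : IsTestFunction Ω (-φ) := (testFunctionSubmodule Ω).neg_mem hφ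
  have h := key (-φ) hneg i
  rw [eLpNorm_neg] at h
  refine le_trans (le_of_eq ?_) h
  rw [← integral_neg]
  congr 1
  funext x
  simp [partialDeriv, fderiv_neg]

/-- The power `d + 1` suffices because `(d + 1) q > d` whenever `q ≥ 1`. -/
theorem memLp_inv_one_add_norm_pow {d : ℕ} {q : ℝ} (hq : 1 ≤ q) :
    MemLp (fun x : EuclideanSpace ℝ (Fin d) => ((1 + ‖x‖) ^ (d + 1))⁻¹) (ENNReal.ofReal q)
      volume := by
  have hq0 : 0 < q := one_pos.trans_le hq
  have hm : Measurable fun x : EuclideanSpace ℝ (Fin d) => ((1 + ‖x‖) ^ (d + 1))⁻¹ := by fun_prop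
  rw [← integrable_norm_rpow_iff hm.aestronglyMeasurable (by simpa using hq0)
    ENNReal.ofReal_ne_top, ENNReal.toReal_ofReal hq0.le]
  have hr : (Module.finrank ℝ (EuclideanSpace ℝ (Fin d)) : ℝ) < ((d : ℝ) + 1) * q := by
    rw [finrank_euclideanSpace_fin]
    nlinarith [(Nat.cast_nonneg d : (0 : ℝ) ≤ d)]
  refine (integrable_one_add_norm (μ := volume) hr).congr (ae_of_all _ fun x => ?_)
  have hx : 0 ≤ 1 + ‖x‖ := by positivity
  simp only
  rw [Real.norm_of_nonneg (by positivity), Real.inv_rpow (by positivity), Real.rpow_neg hx,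
    Real.rpow_mul hx]
  norm_cast

/-- A distributional derivative that is bounded in the dual of `L^q` is a locally integrable
function. -/
theorem exists_weak_partialDeriv {d : ℕ} {p q : ℝ} (hp : 1 ≤ p) (hq : 1 ≤ q)
    {Ω : Set (EuclideanSpace ℝ (Fin d))}
    {u : EuclideanSpace ℝ (Fin d) → ℝ} (hu : MemLp u (ENNReal.ofReal p) (volume.restrict Ω))
    {C : ℝ} (i : Fin d)
    (hC : ∀ φ : EuclideanSpace ℝ (Fin d) → ℝ, IsTestFunction Ω φ →
      |∫ x in Ω, u x * partialDeriv i φ x| ≤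
        C * (eLpNorm φ (ENNReal.ofReal q) (volume.restrict Ω)).toReal) :
    ∃ g : EuclideanSpace ℝ (Fin d) → ℝ,
      (∀ K, IsCompact K → IntegrableOn g K (volume.restrict Ω)) ∧
      ∀ φ : EuclideanSpace ℝ (Fin d) → ℝ, IsTestFunction Ω φ →
        ∫ x in Ω, u x * partialDeriv i φ x = -∫ x in Ω, g x * φ x := by
  have : Fact (1 ≤ ENNReal.ofReal q) := ⟨by simpa using hq⟩
  let T : testFunctionSubmodule Ω →ₗ[ℝ] Lp ℝ (ENNReal.ofReal q) (volume.restrict Ω) :=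
    { toFun := fun φ => (IsTestFunction.memLp φ.2 _ Ω).toLp φ.1
      map_add' := fun φ ψ => rfl
      map_smul' := fun c φ => rfl }
  let ℓ : testFunctionSubmodule Ω →ₗ[ℝ] ℝ :=
    { toFun := fun φ => ∫ x in Ω, u x * partialDeriv i φ.1 x
      map_add' := fun φ ψ => by
        rw [← integral_add
          (IsTestFunction.integrable_mul_partialDeriv hp hu φ.2 i)
          (IsTestFunction.integrable_mul_partialDeriv hp hu ψ.2 i)]
        congr 1
        funext x
        simp only [partialDeriv, Submodule.coe_add]
        rw [fderiv_add (φ.2.smooth.differentiable (by simp) x)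
          (ψ.2.smooth.differentiable (by simp) x)]
        simp [mul_add]
      map_smul' := fun c φ => by
        rw [RingHom.id_apply, smul_eq_mul, ← integral_const_mul]
        congr 1
        funext x
        simp only [partialDeriv, Submodule.coe_smul]
        rw [fderiv_const_smul (φ.2.smooth.differentiable (by simp) x)]
        simp [mul_left_comm] }
  obtain ⟨L, hL⟩ := exists_dual_comp_eq T ℓ C fun φ => by
    have hT : ‖T φ‖ = (eLpNorm φ.1 (ENNReal.ofReal q) (volume.restrict Ω)).toReal :=
      Lp.norm_toLp φ.1 (IsTestFunction.memLp φ.2 _ Ω)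
    rw [hT]
    exact hC φ.1 φ.2
  -- A strictly positive continuous weight in `L^q`: every test function is `w` times a bounded
  -- function, namely `φ / w`, so the density relative to `w` sees all of them.
  let w : EuclideanSpace ℝ (Fin d) → ℝ := fun x => ((1 + ‖x‖) ^ (d + 1))⁻¹
  have hwm : Measurable w := by fun_prop
  have hw : MemLp w (ENNReal.ofReal q) (volume.restrict Ω) :=
    (memLp_inv_one_add_norm_pow hq).restrict Ω
  obtain ⟨g, hg, hgL⟩ := exists_integrable_dual_density ENNReal.ofReal_ne_top hwm hw L
  have hcont : Continuous fun x : EuclideanSpace ℝ (Fin d) => (1 + ‖x‖) ^ (d + 1) := by fun_prop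
  -- The weak derivative is `-g / w`. As `1 / w` is bounded only on bounded sets, this step gives
  -- integrability on compact sets only.
  refine ⟨fun x => -(g x * (1 + ‖x‖) ^ (d + 1)), fun K hK =>
    (hg.integrableOn.mul_continuousOn hcont.continuousOn hK).neg, fun φ hφ => ?_⟩
  have hs : Continuous fun x => φ x * (1 + ‖x‖) ^ (d + 1) := hφ.smooth.continuous.mul hcont
  have hsc : HasCompactSupport fun x => φ x * (1 + ‖x‖) ^ (d + 1) := hφ.hasCompactSupport.mul_right
  have heq : (fun x => φ x * (1 + ‖x‖) ^ (d + 1) * w x) = φ := by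
    funext x
    have : (1 + ‖x‖) ^ (d + 1) ≠ 0 := by positivity
    simp only [w]
    rw [mul_assoc, mul_inv_cancel₀ this, mul_one]
  have hmem : MemLp (fun x => φ x * (1 + ‖x‖) ^ (d + 1) * w x) (ENNReal.ofReal q)
      (volume.restrict Ω) := by
    rw [heq]
    exact hφ.memLp _ Ω
  have h1 := hgL _ hs.measurable (hsc.exists_bound_of_continuous hs) hmem
  have h2 : hmem.toLp _ = T ⟨φ, hφ⟩ :=
    MemLp.toLp_congr hmem (hφ.memLp _ Ω) (ae_of_all _ fun x => congrFun heq x)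
  rw [h2, hL] at h1
  refine h1.trans ?_
  rw [← integral_neg]
  congr 1
  funext x
  ring

theorem exists_isWeakGradient {d : ℕ} {p q : ℝ} (hp : 1 ≤ p) (hq : 1 ≤ q)
    {Ω : Set (EuclideanSpace ℝ (Fin d))}
    {u : EuclideanSpace ℝ (Fin d) → ℝ} (hu : MemLp u (ENNReal.ofReal p) (volume.restrict Ω))
    {C : ℝ} (hC : ∀ φ : EuclideanSpace ℝ (Fin d) → ℝ, IsTestFunction Ω φ → ∀ i : Fin d,
      |∫ x in Ω, u x * partialDeriv i φ x| ≤
        C * (eLpNorm φ (ENNReal.ofReal q) (volume.restrict Ω)).toReal) :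
    ∃ g, IsWeakGradient Ω u g := by
  choose g hgi hg using fun i =>
    exists_weak_partialDeriv hp hq hu i (fun φ hφ => hC φ hφ i)
  refine ⟨fun x => ∑ i, g i x • EuclideanSpace.single i (1 : ℝ), ?_, fun φ hφ i => ?_⟩
  · intro x hx
    -- Each component is integrable over the intersection of `Ω` with any compact set, even one
    -- reaching the boundary, so the ball need not lie inside `Ω`.
    refine ⟨Metric.closedBall x 1 ∩ Ω,
      inter_mem (mem_nhdsWithin_of_mem_nhds (Metric.closedBall_mem_nhds x one_pos))
        self_mem_nhdsWithin, ?_⟩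
    rw [IntegrableOn, ← Measure.restrict_restrict Metric.isClosed_closedBall.measurableSet]
    exact integrable_finsetSum _ fun i _ => (hgi i _ (isCompact_closedBall x 1)).smul_const _
  · rw [hg i φ hφ]
    congr 2
    funext x
    simp [Finset.sum_apply, Pi.single_apply]

theorem IsDiracApproxPLevy.mul_gradLpPow_le {d : ℕ} {p : ℝ} (hp : 1 < p)
    {ν : ℝ → EuclideanSpace ℝ (Fin d) → ℝ≥0∞} (hν : IsDiracApproxPLevy d p ν)
    {e : EuclideanSpace ℝ (Fin d)} (he : ‖e‖ = 1)
    {Ω : Set (EuclideanSpace ℝ (Fin d))} (hΩ : IsOpen Ω)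
    {u : EuclideanSpace ℝ (Fin d) → ℝ} (hu : MemLp u (ENNReal.ofReal p) (volume.restrict Ω)) :
    ENNReal.ofReal (sphereMean d p e) * gradLpPow p Ω u ≤ liminfEnergy p ν Ω u := by
  by_cases hA : liminfEnergy p ν Ω u = ⊤
  · rw [hA]; exact le_top
  have hpq := Real.HolderConjugate.conjExponent hp
  obtain ⟨C, hC⟩ := hν.exists_abs_integral_mul_partialDeriv_le hpq he hΩ hu hA
  obtain ⟨g, hg⟩ := exists_isWeakGradient hp.le hpq.symm.lt.le hu hC
  exact (mul_le_mul_right (iInf₂_le g hg) _).trans (hg.setLIntegral_le hp.le hν he hΩ hu)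

theorem mainTheorem3 (d : ℕ) (p : ℝ) (hp : 1 ≤ p)
    (ν : ℝ → EuclideanSpace ℝ (Fin d) → ℝ≥0∞) (hν : IsDiracApproxPLevy d p ν)
    (e : EuclideanSpace ℝ (Fin d)) (he : ‖e‖ = 1)
    (Ω : Set (EuclideanSpace ℝ (Fin d))) (hΩ : IsOpen Ω)
    (u : EuclideanSpace ℝ (Fin d) → ℝ) :
    (((1 < p ∧ MemLp u (ENNReal.ofReal p) (volume.restrict Ω)) ∨
        (p = 1 ∧ MemSobolevOne 1 Ω u)) →
      ENNReal.ofReal (sphereMean d p e) * gradLpPow p Ω u ≤ liminfEnergy p ν Ω u) ∧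
    (p = 1 → MemLp u 1 (volume.restrict Ω) →
      ENNReal.ofReal (sphereMean d 1 e) * bvSeminorm Ω u ≤ liminfEnergy 1 ν Ω u) := by
  refine ⟨?_, ?_⟩
  · rintro (⟨hp1, hu⟩ | ⟨rfl, hu, g, hg, -⟩)
    · exact hν.mul_gradLpPow_le hp1 he hΩ hu
    · exact (mul_le_mul_right (iInf₂_le g hg) _).trans (hg.setLIntegral_le hp hν he hΩ hu)
  · rintro rfl hu
    exact hν.mul_bvSeminorm_le he hΩ hu
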